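/- Let $m,n\in\mathbb N$ be coprime with $\frac12<\frac mn<1$. Then there is a closed smoothly immersed plane curve $x:\mathbb S^1\to\mathbb R^2$ with the following properties. (1) $x$ is a shrinker of the area-preserving curve-shortening flow: there are $T>0$, a smooth family of immersions $X:\mathbb S^1\times[0,T)\to\mathbb R^2$ with $X(\cdot,0)=x$, whose normal velocity is $\langle\partial_tX,N\rangle=k-\bar k$, a point $p\in\mathbb R^2$ and a monotone function $\psi\in C^1([0,T))$ with $\dot\psi\le 0$ such that $X(\cdot,t)=p+\psi(t)\,(X(\cdot,0)-p)$ for all $t\in[0,T)$. Here $N(\cdot,t)$ is the unit normal of $X(\cdot,t)$ obtained from the unit tangent by a counterclockwise quarter turn, $k(\cdot,t)$ is the signed curvature with respect to $N(\cdot,t)$, and $\bar k(t)=\frac{1}{\operatorname{len}(t)}\int_{\mathbb S^1}k(\cdot,t)\,ds$ is the average curvature. (2) $x$ is non-circular, i.e. its trace $x(\mathbb S^1)$ is not contained in a circle. (3) $x$ is $n$-symmetric: for a suitable center, the rotations about it that map the trace $x(\mathbb S^1)$ onto itself are exactly those by the integer multiples of $2\pi/n$. (4) $x$ has tangent turning index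 $m$, i.e. a continuous tangent angle increases by $2\pi m$ along $x$. Moreover, $x$ is a $\lambda$-curve with $\lambda=\bar\kappa[x]$, its average curvature: with the curvature $\kappa$ and the normal $\mathsf n$ of $x$ as in (1), there are $\delta>0$ and $x_\ast\in\mathbb R^2$ such that $\kappa=\delta\langle x-x_\ast,-\mathsf n\rangle+\bar\kappa[x]$ on $\mathbb S^1$; and $x$ encloses zero signed area, $\frac12\int_{\mathbb S^1}\langle x,-\mathsf n\rangle\,ds=0$. -/

import Mathlib

open scoped ContDiff

noncomputable section

namespace PlaneCurve

/-- A closed curve immersed smoothly in the plane `ℂ = ℝ²`: the circle is `ℝ / 2πℤ`, and a map on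
the circle is a `2π`-periodic map on `ℝ`. -/
structure IsClosedImmersion (x : ℝ → ℂ) : Prop where
  smooth : ContDiff ℝ ∞ x
  periodic : Function.Periodic x (2 * Real.pi)
  immersion : ∀ u, deriv x u ≠ 0

/-- The unit tangent. -/
def tangent (x : ℝ → ℂ) (u : ℝ) : ℂ := deriv x u / (‖deriv x u‖ : ℂ)

/-- The unit normal obtained from the unit tangent by a quarter turn to the left. It is the inward
normal of a positively oriented locally convex curve. -/
def normal (x : ℝ → ℂ) (u : ℝ) : ℂ := Complex.I * tangent x u

/-- The signed curvature with respect to `normal`. -/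
def curvature (x : ℝ → ℂ) (u : ℝ) : ℝ :=
  inner ℝ (deriv (deriv x) u) (normal x u) / ‖deriv x u‖ ^ 2

/-- The length of a closed curve. -/
def length (x : ℝ → ℂ) : ℝ := ∫ u in (0 : ℝ)..(2 * Real.pi), ‖deriv x u‖

/-- The average curvature, `(1 / len) ∫ k ds`. -/
def avgCurvature (x : ℝ → ℂ) : ℝ :=
  (1 / length x) * ∫ u in (0 : ℝ)..(2 * Real.pi), curvature x u * ‖deriv x u‖

/-- The signed area enclosed by a closed curve, `(1 / 2) ∫ ⟨x, -N⟩ ds`; a circle run through once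
counterclockwise encloses a positive area. -/
def signedArea (x : ℝ → ℂ) : ℝ :=
  (1 / 2) * ∫ u in (0 : ℝ)..(2 * Real.pi), inner ℝ (x u) (-normal x u) * ‖deriv x u‖

/-- The closed curve `x` has tangent turning index `m`: a continuous tangent angle grows by `2πm`
in one period. -/
def HasTurningIndex (x : ℝ → ℂ) (m : ℤ) : Prop :=
  ∃ θ : ℝ → ℝ, Continuous θ ∧
    (∀ u, tangent x u = Complex.exp ((θ u : ℂ) * Complex.I)) ∧
    ∀ u, θ (u + 2 * Real.pi) = θ u + 2 * Real.pi * m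

/-- The curve lies on a circle. -/
def IsCircular (x : ℝ → ℂ) : Prop := ∃ (c : ℂ) (r : ℝ), ∀ u, ‖x u - c‖ = r

/-- The rotation of the plane about `c` by the angle `α`. -/
def rotationAbout (c : ℂ) (α : ℝ) (z : ℂ) : ℂ := c + Complex.exp ((α : ℂ) * Complex.I) * (z - c)

/-- The trace of `x` has `n`-fold rotational symmetry, and not more: the rotations about a suitable
center which map it onto itself are exactly those by the integer multiples of `2π / n`. -/
def IsRotSymmetric (n : ℕ) (x : ℝ → ℂ) : Prop :=
  ∃ c : ℂ, ∀ α : ℝ,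
    rotationAbout c α '' Set.range x = Set.range x ↔ ∃ j : ℤ, α = 2 * Real.pi * j / n

/-- The curve `x` is a `λ`-curve for the parameter `l`: its curvature is
`δ ⟨x - p, -N⟩ + l` with some `δ > 0` and some point `p`, where `-N` is the outward normal. -/
def IsLambdaCurve (l : ℝ) (x : ℝ → ℂ) : Prop :=
  ∃ (δ : ℝ) (p : ℂ), 0 < δ ∧ ∀ u, curvature x u = δ * inner ℝ (x u - p) (-normal x u) + l

/-- The family `X t`, `0 ≤ t < T`, of closed curves is a smooth evolution by the area-preserving
curve-shortening flow (up to tangential reparametrization): its normal velocity is `k - k̄`. -/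
structure IsAPCSF (T : ℝ) (X : ℝ → ℝ → ℂ) : Prop where
  smooth : ContDiffOn ℝ ∞ (fun z : ℝ × ℝ => X z.1 z.2) (Set.Ico 0 T ×ˢ Set.univ)
  immersion : ∀ t ∈ Set.Ico 0 T, IsClosedImmersion (X t)
  normal_velocity : ∀ t ∈ Set.Ico 0 T, ∀ u,
    inner ℝ (derivWithin (fun s => X s u) (Set.Ico 0 T) t) (normal (X t) u) =
      curvature (X t) u - avgCurvature (X t)

/-- The family `X t`, `0 ≤ t < T`, moves by homothety with scaling function `ψ` and center `p`. -/
structure IsHomothetic (T : ℝ) (X : ℝ → ℝ → ℂ) (ψ : ℝ → ℝ) (p : ℂ) : Prop where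
  contDiffOn : ContDiffOn ℝ 1 ψ (Set.Ico 0 T)
  monotone : MonotoneOn ψ (Set.Ico 0 T) ∨ AntitoneOn ψ (Set.Ico 0 T)
  homothety : ∀ t ∈ Set.Ico 0 T, ∀ u, X t u = p + (ψ t : ℂ) * (X 0 u - p)

/-- The curve `x` is a shrinker of the area-preserving curve-shortening flow: it is the initial
curve of an evolution which moves by homothety with a scaling function of derivative `≤ 0`. -/
def IsAPCSFShrinker (x : ℝ → ℂ) : Prop :=
  ∃ (T : ℝ) (X : ℝ → ℝ → ℂ) (ψ : ℝ → ℝ) (p : ℂ),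
    0 < T ∧ IsAPCSF T X ∧ X 0 = x ∧ IsHomothetic T X ψ p ∧
      ∀ t ∈ Set.Ico 0 T, derivWithin ψ (Set.Ico 0 T) t ≤ 0

end PlaneCurve

end

/-! For a locally convex curve with tangent angle `θ` and support function `h`, the equation `κ = δ
h + λ` turns into an ODE through `h'' + h = 1/κ`. Let `y = h + c` be the multiple of the curvature
that oscillates between `e^{-σ}` and `e^σ`. Then `y'' + y - c = ε / y`, with first integral `y'² =
(y - e^{-σ})(e^σ - y) + 2d (cosh σ + v sinh σ - y)`, where `y = e^{σ v}`, `c = cosh σ - d` and `ε =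
d sinh σ / σ`. Both summands vanish at the turning points `v = ±1`. Substituting `v = cos φ`
therefore cancels the zeros and gives `dθ/dφ = y / √weight` with a smooth positive weight. Every `σ,
d > 0` thus yields an explicit arc with `κ = y/ε`, `δ = 1/ε`, `λ = c/ε`.

Two conditions remain. Integrating `κ = δ h + λ` over a closed curve shows that `λ` is the average
curvature exactly when the signed area is zero, that is `areaIntegral σ d = 0`. The curve closes up
after `n` periods with turning index `m` when `halfTurn σ d = π m / n`.

For fixed `σ` the area integral decreases strictly in `d` (`weight_quotient_strictAntiOn`), from a
positive value at `d = 0` to a negative one at `d = sinh σ`, so it has a unique zero `d(σ)`,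
continuous in `σ`. Along `d(σ)` the half turn comes close to `π` for small `σ`
(`eventually_lt_halfTurn`) and falls below any number above `π/2` for large `σ`
(`eventually_halfTurn_lt`). By continuity all values in `(π/2, π)` occur (`exists_halfTurn_eq`).

A `λ`-curve with `λ` its average curvature shrinks homothetically. The exact symmetry group is read
off from the farthest points, because `|x|²` is affine in `cos φ`. -/

noncomputable section

namespace PlaneCurve

/-! ### The function `(exp x - 1) / x` -/

/-- The slope of the exponential function between `0` and `x`. -/
def expSlope (x : ℝ) : ℝ := dslope Real.exp 0 x

theorem mul_expSlope (x : ℝ) : x * expSlope x = Real.exp x - 1 := by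
  simpa [expSlope] using sub_smul_dslope Real.exp 0 x

theorem expSlope_zero : expSlope 0 = 1 := by simp [expSlope]

theorem contDiff_expSlope {k : WithTop ℕ∞} : ContDiff ℝ k expSlope := by
  refine contDiff_iff_contDiffAt.2 fun x => ?_
  rcases eq_or_ne x 0 with rfl | hx
  · obtain ⟨p, hp⟩ : AnalyticAt ℝ Real.exp 0 := analyticAt_rexp
    exact AnalyticAt.contDiffAt ⟨_, hp.has_fpower_series_dslope_fslope⟩
  · have h : ContDiffAt ℝ k (fun y : ℝ => (Real.exp y - 1) / y) x :=
      (Real.contDiff_exp.contDiffAt.sub contDiffAt_const).div contDiffAt_id hx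
    refine h.congr_of_eventuallyEq ?_
    filter_upwards [isOpen_ne.mem_nhds hx] with y hy
    rw [eq_div_iff hy, mul_comm, mul_expSlope]

theorem continuous_expSlope : Continuous expSlope :=
  (contDiff_expSlope (k := 0)).continuous

theorem one_le_expSlope {x : ℝ} (hx : 0 ≤ x) : 1 ≤ expSlope x := by
  rcases hx.eq_or_lt with rfl | hx
  · rw [expSlope_zero]
  · nlinarith [mul_expSlope x, Real.add_one_le_exp x]

theorem one_lt_expSlope {x : ℝ} (hx : 0 < x) : 1 < expSlope x := by
  nlinarith [mul_expSlope x, Real.add_one_lt_exp hx.ne']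

theorem expSlope_le_one {x : ℝ} (hx : x ≤ 0) : expSlope x ≤ 1 := by
  rcases hx.eq_or_lt with rfl | hx
  · rw [expSlope_zero]
  · nlinarith [mul_expSlope x, Real.add_one_le_exp x]

theorem expSlope_lt_one {x : ℝ} (hx : x < 0) : expSlope x < 1 := by
  nlinarith [mul_expSlope x, Real.add_one_lt_exp hx.ne]

theorem expSlope_pos (x : ℝ) : 0 < expSlope x := by
  rcases lt_trichotomy x 0 with hx | rfl | hx
  · have := Real.exp_lt_exp.2 hx
    rw [Real.exp_zero] at this
    nlinarith [mul_expSlope x]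
  · simp [expSlope_zero]
  · exact zero_lt_one.trans (one_lt_expSlope hx)

theorem exp_mul_one_sub_le (x : ℝ) : Real.exp x * (1 - x) ≤ 1 := by
  have h := Real.add_one_le_exp (-x)
  have h2 : Real.exp x * Real.exp (-x) = 1 := by rw [← Real.exp_add]; simp
  nlinarith [Real.exp_pos x]

theorem expSlope_le_exp {x : ℝ} (hx : 0 ≤ x) : expSlope x ≤ Real.exp x := by
  rcases hx.eq_or_lt with rfl | hx
  · simp [expSlope_zero]
  · nlinarith [mul_expSlope x, exp_mul_one_sub_le x]

theorem exp_le_expSlope {x : ℝ} (hx : x ≤ 0) : Real.exp x ≤ expSlope x := by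
  rcases hx.eq_or_lt with rfl | hx
  · simp [expSlope_zero]
  · nlinarith [mul_expSlope x, exp_mul_one_sub_le x]

/-! ### The weights

A curvature function oscillating between multiples of `exp (-σ)` and `exp σ` is written as a multiple
of `exp (σ * cos φ)`. The tangent angle is then a primitive of
`exp (σ * cos φ) / √(weight σ d (cos φ))`, where `d` is a second parameter. -/

/-- The weight of a circle with an eccentric support center. -/
def circWeight (σ v : ℝ) : ℝ :=
  Real.exp (σ * (v - 1)) * expSlope (σ * (1 + v)) * expSlope (σ * (1 - v))

/-- The normalized gap between the exponential function and its chord. -/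
def gapWeight (σ v : ℝ) : ℝ :=
  Real.exp (σ * v) * (expSlope (σ * (1 - v)) - expSlope (-(σ * (1 + v)))) / (2 * σ)

/-- The weight for the parameters `σ` and `d`. -/
def weight (σ d v : ℝ) : ℝ := circWeight σ v + 2 * d * gapWeight σ v

/-- The two `expSlope` factors absorb the simple zeros of the right-hand side at `v = -1` and `v =
1`. -/
theorem circWeight_mul (σ v : ℝ) :
    σ ^ 2 * (1 - v ^ 2) * circWeight σ v =
      (Real.exp (σ * v) - Real.exp (-σ)) * (Real.exp σ - Real.exp (σ * v)) := by
  have e1 : σ * (1 + v) = σ + σ * v := by ring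
  have e2 : σ * (1 - v) = σ + -(σ * v) := by ring
  have e3 : σ * (v - 1) = σ * v + -σ := by ring
  have h1 := mul_expSlope (σ * (1 + v))
  have h2 := mul_expSlope (σ * (1 - v))
  have h : σ ^ 2 * (1 - v ^ 2) * circWeight σ v = Real.exp (σ * (v - 1)) *
      (σ * (1 + v) * expSlope (σ * (1 + v))) * (σ * (1 - v) * expSlope (σ * (1 - v))) := by
    rw [circWeight]; ring
  rw [h, h1, h2, e1, e2, e3, Real.exp_add, Real.exp_add, Real.exp_add, Real.exp_neg, Real.exp_neg]
  have := Real.exp_pos σ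
  have := Real.exp_pos (σ * v)
  field_simp

/-- The chord is the convex combination of `e^σ` and `e^{-σ}` with weights `(1 ± v)/2`. Each
difference from `e^{σ v}` is expressed by a slope. -/
theorem gapWeight_mul {σ : ℝ} (hσ : σ ≠ 0) (v : ℝ) :
    σ ^ 2 * (1 - v ^ 2) * gapWeight σ v =
      Real.cosh σ + v * Real.sinh σ - Real.exp (σ * v) := by
  have e1 : -(σ * (1 + v)) = -σ + -(σ * v) := by ring
  have e2 : σ * (1 - v) = σ + -(σ * v) := by ring
  have h1 := mul_expSlope (-(σ * (1 + v)))
  have h2 := mul_expSlope (σ * (1 - v))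
  have h : σ ^ 2 * (1 - v ^ 2) * gapWeight σ v = Real.exp (σ * v) *
      ((1 + v) * (σ * (1 - v) * expSlope (σ * (1 - v))) +
        (1 - v) * (-(σ * (1 + v)) * expSlope (-(σ * (1 + v))))) / 2 := by
    rw [gapWeight]; field_simp; ring
  rw [h, h1, h2, e1, e2, Real.cosh_eq, Real.sinh_eq, Real.exp_add, Real.exp_add, Real.exp_neg (σ * v)]
  have := Real.exp_pos (σ * v)
  field_simp
  ring

theorem weight_mul {σ : ℝ} (hσ : σ ≠ 0) (d v : ℝ) :
    σ ^ 2 * (1 - v ^ 2) * weight σ d v =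
      (Real.exp (σ * v) - Real.exp (-σ)) * (Real.exp σ - Real.exp (σ * v)) +
        2 * d * (Real.cosh σ + v * Real.sinh σ - Real.exp (σ * v)) := by
  rw [← circWeight_mul, ← gapWeight_mul hσ, weight]; ring

theorem circWeight_pos (σ v : ℝ) : 0 < circWeight σ v :=
  mul_pos (mul_pos (Real.exp_pos _) (expSlope_pos _)) (expSlope_pos _)

theorem gapWeight_pos {σ v : ℝ} (hσ : 0 < σ) (hv : -1 ≤ v) (hv' : v ≤ 1) : 0 < gapWeight σ v := by
  refine div_pos (mul_pos (Real.exp_pos _) (sub_pos.2 ?_)) (by positivity)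
  -- At `v = 1` the first slope equals `1`, so strictness has to come from the second.
  rcases hv'.eq_or_lt with rfl | hv'
  · exact (expSlope_lt_one (by nlinarith)).trans_le (one_le_expSlope (by simp))
  · exact (expSlope_le_one (by nlinarith)).trans_lt (one_lt_expSlope (by nlinarith))

theorem weight_pos {σ d v : ℝ} (hσ : 0 < σ) (hd : 0 ≤ d) (hv : -1 ≤ v) (hv' : v ≤ 1) :
    0 < weight σ d v := by
  have := circWeight_pos σ v
  have := gapWeight_pos hσ hv hv'
  rw [weight]; positivity

theorem circWeight_le {σ v : ℝ} (hσ : 0 < σ) (hv : -1 ≤ v) (hv' : v ≤ 1) :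
    circWeight σ v ≤ Real.exp (2 * σ) := by
  have h1 := expSlope_le_exp (x := σ * (1 + v)) (by nlinarith)
  have h2 := expSlope_le_exp (x := σ * (1 - v)) (by nlinarith)
  calc circWeight σ v
      ≤ Real.exp (σ * (v - 1)) * Real.exp (σ * (1 + v)) * Real.exp (σ * (1 - v)) := by
        rw [circWeight]
        have := expSlope_pos (σ * (1 - v))
        gcongr
    _ = Real.exp (σ * (1 + v)) := by rw [← Real.exp_add, ← Real.exp_add]; ring_nf
    _ ≤ Real.exp (2 * σ) := Real.exp_le_exp.2 (by nlinarith)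

theorem sinh_le_mul_exp {σ : ℝ} (hσ : 0 ≤ σ) : Real.sinh σ ≤ σ * Real.exp σ := by
  have h1 := exp_mul_one_sub_le (2 * σ)
  have h2 : Real.exp (2 * σ) = Real.exp σ * Real.exp σ := by rw [← Real.exp_add]; ring_nf
  have h3 : Real.exp σ * Real.exp (-σ) = 1 := by rw [← Real.exp_add]; simp
  rw [Real.sinh_eq]
  have := Real.exp_pos σ
  refine le_of_mul_le_mul_left ?_ this
  nlinarith

/-- The point of the bound is that it tends to `1` as `σ → 0`, uniformly in `v` and `d`. -/
theorem weight_le {σ d v : ℝ} (hσ : 0 < σ) (hd' : d ≤ Real.sinh σ) (hv : -1 ≤ v)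
    (hv' : v ≤ 1) : weight σ d v ≤ Real.exp (2 * σ) + Real.exp (4 * σ) - 1 := by
  have h0 := circWeight_le hσ hv hv'
  have h1 := expSlope_le_exp (x := σ * (1 - v)) (by nlinarith)
  have h2 := exp_le_expSlope (x := -(σ * (1 + v))) (by nlinarith)
  have h3 : gapWeight σ v ≤
      Real.exp σ * (Real.exp (2 * σ) - Real.exp (-(2 * σ))) / (2 * σ) := by
    rw [gapWeight]
    have h4 : Real.exp (σ * (1 - v)) ≤ Real.exp (2 * σ) := Real.exp_le_exp.2 (by nlinarith)
    have h5 : Real.exp (-(2 * σ)) ≤ Real.exp (-(σ * (1 + v))) := Real.exp_le_exp.2 (by nlinarith)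
    have h6 : Real.exp (σ * v) ≤ Real.exp σ := Real.exp_le_exp.2 (by nlinarith)
    have h7 : Real.exp (-(2 * σ)) ≤ Real.exp (2 * σ) := Real.exp_le_exp.2 (by nlinarith)
    refine div_le_div_of_nonneg_right ?_ (by positivity)
    refine mul_le_mul_of_nonneg_left (by linarith) (Real.exp_pos _).le |>.trans
      (mul_le_mul_of_nonneg_right h6 (by linarith))
  have h4 : 2 * d * gapWeight σ v ≤ Real.exp (4 * σ) - 1 := by
    have hg := gapWeight_pos hσ hv hv'
    calc 2 * d * gapWeight σ v ≤ 2 * (σ * Real.exp σ) *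
          (Real.exp σ * (Real.exp (2 * σ) - Real.exp (-(2 * σ))) / (2 * σ)) := by
          have := sinh_le_mul_exp hσ.le
          have := hd'.trans this
          gcongr
      _ = Real.exp σ * Real.exp σ * (Real.exp (2 * σ) - Real.exp (-(2 * σ))) := by
          field_simp
      _ = Real.exp (4 * σ) - 1 := by
          rw [← Real.exp_add, mul_sub, ← Real.exp_add, ← Real.exp_add]
          ring_nf
          rw [Real.exp_zero]
          ring
  rw [weight]; linarith

/-! ### Monotonicity in `d` of the area integrand -/

theorem exp_mul_le_chord {σ v : ℝ} (hσ : 0 < σ) (hv : -1 ≤ v) (hv' : v ≤ 1) :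
    Real.exp (σ * v) ≤ Real.cosh σ + v * Real.sinh σ := by
  have h := gapWeight_mul hσ.ne' v
  have := gapWeight_pos hσ hv hv'
  have h2 : 0 ≤ 1 - v ^ 2 := by nlinarith
  have : 0 ≤ σ ^ 2 * (1 - v ^ 2) * gapWeight σ v := by positivity
  linarith

theorem sinh_add_sub_pos {σ v : ℝ} (hσ : 0 < σ) (hv : -1 < v) (hv' : v < 1) :
    0 < Real.sinh σ + v * Real.cosh σ - v * Real.exp (σ * v) := by
  have hS : 0 < Real.sinh σ := Real.sinh_pos_iff.2 hσ
  rcases le_or_gt 0 v with h0 | h0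
  · have := exp_mul_le_chord hσ hv.le hv'.le
    nlinarith [mul_le_mul_of_nonneg_left this h0, mul_pos hS (by nlinarith : 0 < 1 - v ^ 2)]
  · have h1 : Real.exp (-σ) ≤ Real.exp (σ * v) := Real.exp_le_exp.2 (by nlinarith)
    have h2 := Real.cosh_sub_sinh σ
    nlinarith [mul_le_mul_of_nonneg_left h1 (neg_pos.2 h0).le]

/-- With `Y`, `Z` the two weights and `A = cosh σ - e^{σ v}`, the `d`-derivative of `(A - d) / √(Y +
2dZ)` has the sign of `-(Y + A Z + d Z)`, so this positivity makes it negative. Multiplied by `σ² (1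
- v²)`, the expression factors. -/
theorem circWeight_add_pos {σ v : ℝ} (hσ : 0 < σ) (hv : -1 < v) (hv' : v < 1) :
    0 < circWeight σ v + (Real.cosh σ - Real.exp (σ * v)) * gapWeight σ v := by
  have hS : 0 < Real.sinh σ := Real.sinh_pos_iff.2 hσ
  have h1 : 0 < 1 - v ^ 2 := by nlinarith
  have key : σ ^ 2 * (1 - v ^ 2) *
      (circWeight σ v + (Real.cosh σ - Real.exp (σ * v)) * gapWeight σ v) =
      Real.sinh σ * (Real.sinh σ + v * Real.cosh σ - v * Real.exp (σ * v)) := by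
    have e : ∀ a b c d : ℝ, a * (b + c * d) = a * b + c * (a * d) := fun _ _ _ _ => by ring
    rw [e, circWeight_mul, gapWeight_mul hσ.ne', ← Real.cosh_add_sinh σ, ← Real.cosh_sub_sinh σ]
    ring
  have h2 := mul_pos hS (sinh_add_sub_pos hσ hv hv')
  rw [← key] at h2
  exact pos_of_mul_pos_right h2 (by positivity)

theorem contDiff_weight {k : WithTop ℕ∞} (σ d : ℝ) : ContDiff ℝ k (weight σ d) := by
  have hE := contDiff_expSlope (k := k)
  unfold weight circWeight gapWeight
  refine ContDiff.add (ContDiff.mul (ContDiff.mul (by fun_prop) (hE.comp (by fun_prop)))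
    (hE.comp (by fun_prop))) (contDiff_const.mul (ContDiff.div_const (ContDiff.mul (by fun_prop)
      (ContDiff.sub (hE.comp (by fun_prop)) (hE.comp (by fun_prop)))) _))

/-- The integrand of `areaIntegral` decreases in `d`. -/
theorem weight_quotient_strictAntiOn {σ v : ℝ} (hσ : 0 < σ) (hv : -1 < v) (hv' : v < 1) :
    StrictAntiOn (fun d => (Real.cosh σ - d - Real.exp (σ * v)) / √(weight σ d v)) (Set.Ici 0) := by
  intro d₁ h₁ d₂ h₂ h
  have h₁ : 0 ≤ d₁ := h₁
  have h₂ : 0 ≤ d₂ := h₂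
  have hY := circWeight_pos σ v
  have hZ := gapWeight_pos hσ hv.le hv'.le
  have hYZ := circWeight_add_pos hσ hv hv'
  have hw₁ := weight_pos hσ h₁ hv.le hv'.le
  have hw₂ := weight_pos hσ h₂ hv.le hv'.le
  have r₁ := Real.sqrt_pos.2 hw₁
  have r₂ := Real.sqrt_pos.2 hw₂
  have s₁ : √(weight σ d₁ v) ^ 2 = circWeight σ v + 2 * d₁ * gapWeight σ v := Real.sq_sqrt hw₁.le
  have s₂ : √(weight σ d₂ v) ^ 2 = circWeight σ v + 2 * d₂ * gapWeight σ v := Real.sq_sqrt hw₂.le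
  have hlt : √(weight σ d₁ v) < √(weight σ d₂ v) := by
    refine Real.sqrt_lt_sqrt hw₁.le ?_
    unfold weight; gcongr
  change _ / √(weight σ d₂ v) < _ / √(weight σ d₁ v)
  generalize √(weight σ d₁ v) = a at *
  generalize √(weight σ d₂ v) = b at *
  generalize circWeight σ v = Y at *
  generalize gapWeight σ v = Z at *
  generalize Real.cosh σ = C at *
  generalize Real.exp (σ * v) = e at *
  rw [div_lt_div_iff₀ r₂ r₁]
  -- Both squares are at least `Y`, and `b² > Y`; hence the last factor in `key` exceeds `2 (Y + Z
  -- (C - e)) > 0`.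
  have hab : Y < a * b := by nlinarith [mul_nonneg h₁ hZ.le]
  have key : 2 * Z * ((C - d₁ - e) * b - (C - d₂ - e) * a) =
      (b - a) * (a * b + Y + 2 * Z * (C - e)) := by
    linear_combination b * s₁ - a * s₂
  have hpos : 0 < (b - a) * (a * b + Y + 2 * Z * (C - e)) :=
    mul_pos (by linarith) (by nlinarith)
  rw [← key] at hpos
  have := pos_of_mul_pos_right hpos (by positivity)
  linarith

/-! ### The half period and the closing condition -/

/-- Half the turning angle between two successive vertices of maximal curvature. -/
def halfTurn (σ d : ℝ) : ℝ :=
  ∫ φ in (0 : ℝ)..Real.pi, Real.exp (σ * Real.cos φ) / √(weight σ d (Real.cos φ))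

/-- The integral whose vanishing means that the enclosed area is zero. -/
def areaIntegral (σ d : ℝ) : ℝ :=
  ∫ φ in (0 : ℝ)..Real.pi,
    (Real.cosh σ - d - Real.exp (σ * Real.cos φ)) / √(weight σ d (Real.cos φ))

theorem weight_cos_pos {σ d : ℝ} (hσ : 0 < σ) (hd : 0 ≤ d) (φ : ℝ) :
    0 < weight σ d (Real.cos φ) :=
  weight_pos hσ hd (Real.neg_one_le_cos φ) (Real.cos_le_one φ)

theorem continuous_weight_param :
    Continuous fun z : {p : ℝ × ℝ // 0 < p.1 ∧ 0 ≤ p.2} × ℝ =>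
      weight z.1.1.1 z.1.1.2 (Real.cos z.2) := by
  have hE := continuous_expSlope
  unfold weight circWeight gapWeight
  refine Continuous.add (by fun_prop) (Continuous.mul (by fun_prop)
    (Continuous.div (by fun_prop) (by fun_prop) fun z => ?_))
  have := z.1.2.1
  positivity

theorem continuousOn_halfTurn :
    ContinuousOn (fun p : ℝ × ℝ => halfTurn p.1 p.2) {p | 0 < p.1 ∧ 0 ≤ p.2} := by
  rw [continuousOn_iff_continuous_domRestrict]
  refine intervalIntegral.continuous_parametric_intervalIntegral_of_continuous
    (f := fun (p : {p : ℝ × ℝ // 0 < p.1 ∧ 0 ≤ p.2}) φ =>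
      Real.exp (p.1.1 * Real.cos φ) / √(weight p.1.1 p.1.2 (Real.cos φ))) ?_
    (s := fun _ => Real.pi) continuous_const
  exact Continuous.div (by fun_prop) continuous_weight_param.sqrt
    fun z => (Real.sqrt_pos.2 (weight_cos_pos z.1.2.1 z.1.2.2 _)).ne'

theorem continuousOn_areaIntegral :
    ContinuousOn (fun p : ℝ × ℝ => areaIntegral p.1 p.2) {p | 0 < p.1 ∧ 0 ≤ p.2} := by
  rw [continuousOn_iff_continuous_domRestrict]
  refine intervalIntegral.continuous_parametric_intervalIntegral_of_continuous
    (f := fun (p : {p : ℝ × ℝ // 0 < p.1 ∧ 0 ≤ p.2}) φ =>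
      (Real.cosh p.1.1 - p.1.2 - Real.exp (p.1.1 * Real.cos φ)) /
        √(weight p.1.1 p.1.2 (Real.cos φ))) ?_
    (s := fun _ => Real.pi) continuous_const
  exact Continuous.div (by fun_prop) continuous_weight_param.sqrt
    fun z => (Real.sqrt_pos.2 (weight_cos_pos z.1.2.1 z.1.2.2 _)).ne'

theorem continuous_div_sqrt_weight {σ d : ℝ} (hσ : 0 < σ) (hd : 0 ≤ d) {f : ℝ → ℝ}
    (hf : Continuous f) : Continuous fun φ => f φ / √(weight σ d (Real.cos φ)) :=
  hf.div ((contDiff_weight (k := 0) σ d).continuous.comp Real.continuous_cos).sqrt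
    fun φ => (Real.sqrt_pos.2 (weight_cos_pos hσ hd φ)).ne'

theorem cos_mem_Ioo {φ : ℝ} (hφ : φ ∈ Set.Ioo 0 Real.pi) : -1 < Real.cos φ ∧ Real.cos φ < 1 := by
  have h := Real.sin_pos_of_mem_Ioo hφ
  constructor <;> nlinarith [Real.sin_sq_add_cos_sq φ]

theorem strictAntiOn_areaIntegral {σ : ℝ} (hσ : 0 < σ) :
    StrictAntiOn (areaIntegral σ) (Set.Ici 0) := by
  intro d₁ h₁ d₂ h₂ h
  have i₁ := continuous_div_sqrt_weight hσ h₁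
    (f := fun φ => Real.cosh σ - d₁ - Real.exp (σ * Real.cos φ)) (by fun_prop)
  have i₂ := continuous_div_sqrt_weight hσ h₂
    (f := fun φ => Real.cosh σ - d₂ - Real.exp (σ * Real.cos φ)) (by fun_prop)
  rw [← sub_pos, areaIntegral, areaIntegral, ← intervalIntegral.integral_sub
    (i₁.intervalIntegrable _ _) (i₂.intervalIntegrable _ _)]
  refine intervalIntegral.intervalIntegral_pos_of_pos_on ((i₁.sub i₂).intervalIntegrable _ _)
    (fun φ hφ => ?_) Real.pi_pos
  exact sub_pos.2 (weight_quotient_strictAntiOn hσ (cos_mem_Ioo hφ).1 (cos_mem_Ioo hφ).2 h₁ h₂ h)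

/-- Add the integral to its reflection under `φ ↦ π - φ`. Since `circWeight σ (-v) = e^{-2σv}
circWeight σ v`, the summed integrand is `(cosh σ - 1)(1 + e^{σ v}) / √circWeight`. -/
theorem areaIntegral_zero_pos {σ : ℝ} (hσ : 0 < σ) : 0 < areaIntegral σ 0 := by
  have i := continuous_div_sqrt_weight hσ le_rfl
    (f := fun φ => Real.cosh σ - 0 - Real.exp (σ * Real.cos φ)) (by fun_prop)
  have hsymm : areaIntegral σ 0 = ∫ φ in (0 : ℝ)..Real.pi,
      (Real.cosh σ - 0 - Real.exp (σ * Real.cos (Real.pi - φ))) /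
        √(weight σ 0 (Real.cos (Real.pi - φ))) := by
    rw [intervalIntegral.integral_comp_sub_left
      (fun φ => (Real.cosh σ - 0 - Real.exp (σ * Real.cos φ)) / √(weight σ 0 (Real.cos φ)))]
    simp [areaIntegral]
  have i' : Continuous fun φ => (Real.cosh σ - 0 - Real.exp (σ * Real.cos (Real.pi - φ))) /
      √(weight σ 0 (Real.cos (Real.pi - φ))) :=
    i.comp (by fun_prop : Continuous fun φ : ℝ => Real.pi - φ)
  suffices h : 0 < areaIntegral σ 0 + areaIntegral σ 0 by linarith
  nth_rewrite 2 [hsymm]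
  rw [areaIntegral, ← intervalIntegral.integral_add (i.intervalIntegrable _ _)
    (i'.intervalIntegrable _ _)]
  refine intervalIntegral.intervalIntegral_pos_of_pos_on ((i.add i').intervalIntegrable _ _)
    (fun φ _ => ?_) Real.pi_pos
  rw [Real.cos_pi_sub]
  set v := Real.cos φ
  have hY := circWeight_pos σ v
  have h1 : weight σ 0 v = circWeight σ v := by simp [weight]
  have h2 : weight σ 0 (-v) = (Real.exp (σ * -v)) ^ 2 * circWeight σ v := by
    simp only [weight, circWeight, sq, mul_zero, zero_mul, add_zero]
    have : Real.exp (σ * (-v - 1)) =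
        Real.exp (σ * -v) * Real.exp (σ * -v) * Real.exp (σ * (v - 1)) := by
      rw [← Real.exp_add, ← Real.exp_add]
      ring_nf
    rw [this, sub_neg_eq_add, ← sub_eq_add_neg]
    ring
  have hC : 1 < Real.cosh σ := Real.one_lt_cosh.2 hσ.ne'
  have he := Real.exp_pos (σ * v)
  have hr := Real.sqrt_pos.2 hY
  rw [h1, h2, Real.sqrt_mul (sq_nonneg _), Real.sqrt_sq (Real.exp_pos _).le, mul_neg, Real.exp_neg]
  have : (Real.cosh σ - 0 - Real.exp (σ * v)) / √(circWeight σ v) +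
      (Real.cosh σ - 0 - (Real.exp (σ * v))⁻¹) / ((Real.exp (σ * v))⁻¹ * √(circWeight σ v)) =
      (Real.cosh σ - 1) * (1 + Real.exp (σ * v)) / √(circWeight σ v) := by
    field_simp
    ring
  rw [this]
  have : 0 < Real.cosh σ - 1 := by linarith
  positivity

/-- Here `cosh σ - d = e^{-σ}` is the minimum of `e^{σ cos φ}`, so the integrand is negative. -/
theorem areaIntegral_sinh_neg {σ : ℝ} (hσ : 0 < σ) : areaIntegral σ (Real.sinh σ) < 0 := by
  have hS : 0 < Real.sinh σ := Real.sinh_pos_iff.2 hσ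
  have i := continuous_div_sqrt_weight hσ hS.le
    (f := fun φ => Real.cosh σ - Real.sinh σ - Real.exp (σ * Real.cos φ)) (by fun_prop)
  rw [← neg_pos, areaIntegral, ← intervalIntegral.integral_neg]
  refine intervalIntegral.intervalIntegral_pos_of_pos_on (i.neg.intervalIntegrable _ _)
    (fun φ hφ => ?_) Real.pi_pos
  rw [Real.cosh_sub_sinh, ← neg_div]
  refine div_pos ?_ (Real.sqrt_pos.2 (weight_cos_pos hσ hS.le _))
  have : Real.exp (-σ) < Real.exp (σ * Real.cos φ) :=
    Real.exp_lt_exp.2 (by nlinarith [(cos_mem_Ioo hφ).1])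
  linarith

theorem exists_areaIntegral_eq_zero {σ : ℝ} (hσ : 0 < σ) :
    ∃ d, 0 < d ∧ d < Real.sinh σ ∧ areaIntegral σ d = 0 := by
  have hS : 0 < Real.sinh σ := Real.sinh_pos_iff.2 hσ
  have hc : ContinuousOn (areaIntegral σ) (Set.Icc 0 (Real.sinh σ)) :=
    continuousOn_areaIntegral.comp (f := fun d => (σ, d)) (by fun_prop) fun d hd => ⟨hσ, hd.1⟩
  obtain ⟨d, hd, h0⟩ := intermediate_value_Ioo' hS.le hc
    ⟨areaIntegral_sinh_neg hσ, areaIntegral_zero_pos hσ⟩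
  exact ⟨d, hd.1, hd.2, h0⟩

/-- A trial value `a` beside `d σ` gives the area integral a strict sign, which persists for nearby
parameters. Monotonicity in `d` then keeps the zero on the same side of `a`. -/
theorem continuousOn_of_areaIntegral_eq_zero {d : ℝ → ℝ} (hd : ∀ σ, 0 < σ → 0 < d σ)
    (h0 : ∀ σ, 0 < σ → areaIntegral σ (d σ) = 0) : ContinuousOn d (Set.Ioi 0) := by
  intro σ hσ
  have hσ : 0 < σ := hσ
  refine ContinuousAt.continuousWithinAt ?_
  have hev : ∀ᶠ s in nhds σ, 0 < s := lt_mem_nhds hσ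
  have hc : ∀ a, 0 ≤ a → ContinuousAt (fun s => areaIntegral s a) σ := fun a ha =>
    (continuousOn_areaIntegral.comp (f := fun s => (s, a)) (s := Set.Ioi 0) (by fun_prop)
      fun s hs => ⟨hs, ha⟩).continuousAt (Ioi_mem_nhds hσ)
  refine tendsto_order.2 ⟨fun a ha => ?_, fun a ha => ?_⟩
  · rcases lt_or_ge a 0 with h | h
    · filter_upwards [hev] with s hs using h.trans (hd s hs)
    · have hpos : 0 < areaIntegral σ a := by
        rw [← h0 σ hσ]
        exact strictAntiOn_areaIntegral hσ h (hd σ hσ).le ha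
      filter_upwards [hev, (hc a h).eventually (lt_mem_nhds hpos)] with s hs hs'
      rw [← h0 s hs] at hs'
      exact ((strictAntiOn_areaIntegral hs).lt_iff_gt (hd s hs).le h).1 hs'
  · have h : 0 ≤ a := (hd σ hσ).le.trans ha.le
    have hneg : areaIntegral σ a < 0 := by
      rw [← h0 σ hσ]
      exact strictAntiOn_areaIntegral hσ (hd σ hσ).le h ha
    filter_upwards [hev, (hc a h).eventually (gt_mem_nhds hneg)] with s hs hs'
    rw [← h0 s hs] at hs'
    exact ((strictAntiOn_areaIntegral hs).lt_iff_gt h (hd s hs).le).1 hs'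

/-! ### The half turn for small `σ` -/

theorem le_halfTurn {σ d : ℝ} (hσ : 0 < σ) (hd : 0 ≤ d) (hd' : d ≤ Real.sinh σ) :
    Real.pi * (Real.exp (-σ) / √(Real.exp (2 * σ) + Real.exp (4 * σ) - 1)) ≤ halfTurn σ d := by
  have i := continuous_div_sqrt_weight hσ hd (f := fun φ => Real.exp (σ * Real.cos φ)) (by fun_prop)
  have h : ∫ _ in (0 : ℝ)..Real.pi,
      Real.exp (-σ) / √(Real.exp (2 * σ) + Real.exp (4 * σ) - 1) ≤ halfTurn σ d := by
    refine intervalIntegral.integral_mono_on Real.pi_pos.le (by simp)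
      (i.intervalIntegrable _ _) fun φ _ => ?_
    refine div_le_div₀ (Real.exp_pos _).le (Real.exp_le_exp.2 ?_)
      (Real.sqrt_pos.2 (weight_cos_pos hσ hd φ)) (Real.sqrt_le_sqrt ?_)
    · nlinarith [Real.neg_one_le_cos φ]
    · exact weight_le hσ hd' (Real.neg_one_le_cos φ) (Real.cos_le_one φ)
  simpa [mul_div_assoc] using h

theorem eventually_lt_halfTurn {τ : ℝ} (hτ : τ < Real.pi) :
    ∀ᶠ σ in nhdsWithin 0 (Set.Ioi 0), ∀ d, 0 ≤ d → d ≤ Real.sinh σ → τ < halfTurn σ d := by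
  have hc : ContinuousAt (fun σ =>
      Real.pi * (Real.exp (-σ) / √(Real.exp (2 * σ) + Real.exp (4 * σ) - 1))) 0 := by
    refine continuousAt_const.mul (ContinuousAt.div (by fun_prop) (by fun_prop) ?_)
    simp
  have h := (hc.eventually (lt_mem_nhds (a := τ) (by simpa using hτ)))
  filter_upwards [nhdsWithin_le_nhds h, self_mem_nhdsWithin] with σ h1 h2 d hd hd'
  exact h1.trans_le (le_halfTurn h2 hd hd')

/-! ### The half turn for large `σ` -/

/-- This is `|dy/dθ|`; estimates of the first integral thereby become estimates of the half turn. -/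
theorem sqrt_weight_mul {σ d φ : ℝ} (hσ : 0 < σ) (hφ : φ ∈ Set.Ioo 0 Real.pi) :
    σ * Real.sin φ * √(weight σ d (Real.cos φ)) =
      √((Real.exp (σ * Real.cos φ) - Real.exp (-σ)) * (Real.exp σ - Real.exp (σ * Real.cos φ)) +
        2 * d * (Real.cosh σ + Real.cos φ * Real.sinh σ - Real.exp (σ * Real.cos φ))) := by
  have hs := Real.sin_pos_of_mem_Ioo hφ
  rw [← weight_mul hσ.ne', ← Real.sin_sq, ← mul_pow, Real.sqrt_mul (sq_nonneg _),
    Real.sqrt_sq (by positivity)]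

theorem hasDerivAt_exp_mul_cos (σ φ : ℝ) :
    HasDerivAt (fun φ => Real.exp (σ * Real.cos φ))
      (-(σ * Real.sin φ * Real.exp (σ * Real.cos φ))) φ := by
  convert ((Real.hasDerivAt_cos φ).const_mul σ).exp using 1
  ring

/-- The weight grows with `d`, so `d = 0` is the extreme case. There `y = cosh σ + sinh σ cos θ`
describes a circle, and `θ` is an explicit arccosine running from `0` to `π`. -/
theorem halfTurn_le_pi {σ d : ℝ} (hσ : 0 < σ) (hd : 0 ≤ d) : halfTurn σ d ≤ Real.pi := by
  have hS : 0 < Real.sinh σ := Real.sinh_pos_iff.2 hσ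
  have i := continuous_div_sqrt_weight hσ hd (f := fun φ => Real.exp (σ * Real.cos φ)) (by fun_prop)
  have h := intervalIntegral.integral_le_sub_of_hasDeriv_right_of_le
    (g := fun φ => Real.arccos ((Real.exp (σ * Real.cos φ) - Real.cosh σ) / Real.sinh σ))
    (g' := fun φ => Real.exp (σ * Real.cos φ) / √(weight σ 0 (Real.cos φ)))
    (φ := fun φ => Real.exp (σ * Real.cos φ) / √(weight σ d (Real.cos φ)))
    Real.pi_pos.le ?_ ?_ (i.continuousOn.integrableOn_Icc) ?_
  · refine h.trans (le_of_eq ?_)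
    have e1 : (Real.exp (σ * Real.cos Real.pi) - Real.cosh σ) / Real.sinh σ = -1 := by
      rw [Real.cos_pi, div_eq_iff hS.ne', mul_neg_one, ← Real.cosh_sub_sinh]; ring
    have e2 : (Real.exp (σ * Real.cos 0) - Real.cosh σ) / Real.sinh σ = 1 := by
      rw [Real.cos_zero, div_eq_iff hS.ne', mul_one, ← Real.cosh_add_sinh]; ring
    simp only [e1, e2, Real.arccos_neg_one, Real.arccos_one, sub_zero]
  · exact (Real.continuous_arccos.comp (by fun_prop)).continuousOn
  · intro φ hφ
    have hs := Real.sin_pos_of_mem_Ioo hφ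
    have hw := sqrt_weight_mul (d := 0) hσ hφ
    have hpos := weight_cos_pos hσ le_rfl φ
    set e := Real.exp (σ * Real.cos φ) with he
    set t := (e - Real.cosh σ) / Real.sinh σ with ht
    have hst : Real.sinh σ * t = e - Real.cosh σ := by rw [ht]; field_simp
    have hw' : σ * Real.sin φ * √(weight σ 0 (Real.cos φ)) = Real.sinh σ * √(1 - t ^ 2) := by
      rw [hw, ← Real.sqrt_sq hS.le, ← Real.sqrt_mul (sq_nonneg _), Real.sqrt_sq hS.le]
      congr 1
      have : Real.sinh σ ^ 2 * (1 - t ^ 2) = Real.sinh σ ^ 2 - (Real.sinh σ * t) ^ 2 := by ring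
      rw [this, hst, ← Real.cosh_sub_sinh σ, ← Real.cosh_add_sinh σ]
      ring
    have hpos' : 0 < Real.sinh σ * √(1 - t ^ 2) := by
      rw [← hw']
      have := Real.sqrt_pos.2 hpos
      positivity
    have hq : 0 < √(1 - t ^ 2) := pos_of_mul_pos_right hpos' hS.le
    have hq' := Real.sqrt_pos.1 hq
    have ha := (Real.hasDerivAt_arccos (x := t) (by rintro h; rw [h] at hq'; norm_num at hq')
      (by rintro h; rw [h] at hq'; norm_num at hq')).comp φ
      (((hasDerivAt_exp_mul_cos σ φ).sub_const (Real.cosh σ)).div_const (Real.sinh σ))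
    refine (ha.congr_deriv ?_).hasDerivWithinAt
    have hsq := Real.sqrt_pos.2 hpos
    rw [← he]
    field_simp
    linear_combination e * hw'
  · intro φ _
    have h0 := weight_cos_pos hσ le_rfl φ
    refine div_le_div_of_nonneg_left (Real.exp_pos _).le (Real.sqrt_pos.2 h0)
      (Real.sqrt_le_sqrt ?_)
    have := gapWeight_pos hσ (Real.neg_one_le_cos φ) (Real.cos_le_one φ)
    unfold weight
    gcongr

theorem areaIntegral_eq {σ d : ℝ} (hσ : 0 < σ) (hd : 0 ≤ d) :
    areaIntegral σ d = (Real.cosh σ - d) *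
      (∫ φ in (0 : ℝ)..Real.pi, 1 / √(weight σ d (Real.cos φ))) - halfTurn σ d := by
  have i := continuous_div_sqrt_weight hσ hd (f := fun φ => Real.exp (σ * Real.cos φ)) (by fun_prop)
  have i₁ := continuous_div_sqrt_weight hσ hd (f := fun _ => 1) (by fun_prop)
  rw [areaIntegral, halfTurn, ← intervalIntegral.integral_const_mul,
    ← intervalIntegral.integral_sub ((i₁.const_mul _).intervalIntegrable _ _)
      (i.intervalIntegrable _ _)]
  refine intervalIntegral.integral_congr fun φ _ => ?_
  ring

/-- Zero area means `(cosh σ - d) ∫ 1/√weight = halfTurn ≤ π`, while `|dy/dθ| ≤ e^σ` bounds the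
integral below by `2σ/e^σ`. So the center `c` is negligible against `e^σ` for large `σ`. -/
theorem supportCenter_le {σ d : ℝ} (hσ : 0 < σ) (hd : 0 ≤ d) (hd' : d ≤ Real.cosh σ)
    (h0 : areaIntegral σ d = 0) :
    2 * σ * (Real.cosh σ - d) ≤ Real.pi * Real.exp σ := by
  have i₁ := continuous_div_sqrt_weight hσ hd (f := fun _ => 1) (by fun_prop)
  have hS : 0 < Real.sinh σ := Real.sinh_pos_iff.2 hσ
  have hs := Real.exp_pos σ
  have e1 := areaIntegral_eq hσ hd
  have e2 : 2 * σ / Real.exp σ ≤ ∫ φ in (0 : ℝ)..Real.pi, 1 / √(weight σ d (Real.cos φ)) := by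
    have : ∫ φ in (0 : ℝ)..Real.pi, σ / Real.exp σ * Real.sin φ = 2 * σ / Real.exp σ := by
      rw [intervalIntegral.integral_const_mul, integral_sin]
      simp
      ring
    rw [← this]
    refine intervalIntegral.integral_mono_on_of_le_Ioo Real.pi_pos.le
      (by apply Continuous.intervalIntegrable; fun_prop)
      (i₁.intervalIntegrable _ _) fun φ hφ => ?_
    have hw := Real.sqrt_pos.2 (weight_cos_pos hσ hd φ)
    rw [div_mul_eq_mul_div, div_le_div_iff₀ hs hw, one_mul, sqrt_weight_mul hσ hφ]
    refine Real.sqrt_le_iff.2 ⟨hs.le, ?_⟩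
    have hg := exp_mul_le_chord hσ (Real.neg_one_le_cos φ) (Real.cos_le_one φ)
    have hv := Real.cos_le_one φ
    set e := Real.exp (σ * Real.cos φ)
    rw [← Real.cosh_sub_sinh σ, ← Real.cosh_add_sinh σ]
    nlinarith [mul_le_mul_of_nonneg_right hd' (sub_nonneg.2 hg), Real.cosh_sq σ,
      mul_le_mul_of_nonneg_right hv (mul_pos hS (Real.cosh_pos σ)).le, sq_nonneg e]
  have e3 := halfTurn_le_pi hσ hd
  rw [h0] at e1
  have e4 := mul_le_mul_of_nonneg_left e2 (sub_nonneg.2 hd')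
  have : (Real.cosh σ - d) * (2 * σ / Real.exp σ) ≤ Real.pi := by linarith
  rw [mul_div_assoc', div_le_iff₀ hs] at this
  linarith

theorem weight_mul_eq (σ d v : ℝ) :
    (Real.exp (σ * v) - Real.exp (-σ)) * (Real.exp σ - Real.exp (σ * v)) +
        2 * d * (Real.cosh σ + v * Real.sinh σ - Real.exp (σ * v)) =
      Real.exp σ ^ 2 - Real.exp (σ * v) ^ 2 -
        2 * (Real.cosh σ - d) * (Real.exp σ - Real.exp (σ * v)) -
        2 * d * Real.sinh σ * (1 - v) := by
  rw [← Real.cosh_sub_sinh σ, ← Real.cosh_add_sinh σ]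
  ring

theorem one_add_mul_exp_neg_le (x : ℝ) : (1 + x) * Real.exp (-x) ≤ 1 := by
  have := exp_mul_one_sub_le (-x)
  linarith

/-- Away from its minimum, the curvature nearly solves the equation of a harmonic oscillator. -/
theorem le_weight_of_le_exp {σ d v η : ℝ} (hσ : 0 < σ) (hd' : d ≤ Real.cosh σ)
    (hc : 2 * σ * (Real.cosh σ - d) ≤ Real.pi * Real.exp σ) (hv' : v ≤ 1)
    (hη : 0 < η) (hv : η ≤ Real.exp (σ * (v - 1))) :
    Real.exp σ ^ 2 * (1 - (Real.pi / σ + 1 / (η * σ))) * (1 - Real.exp (σ * (v - 1)) ^ 2) ≤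
      (Real.exp (σ * v) - Real.exp (-σ)) * (Real.exp σ - Real.exp (σ * v)) +
        2 * d * (Real.cosh σ + v * Real.sinh σ - Real.exp (σ * v)) := by
  have hS : 0 < Real.sinh σ := Real.sinh_pos_iff.2 hσ
  have hs := Real.exp_pos σ
  have e1 : Real.exp (σ * v) = Real.exp σ * Real.exp (σ * (v - 1)) := by
    rw [← Real.exp_add]; ring_nf
  rw [weight_mul_eq, e1]
  have h1 := one_add_mul_exp_neg_le (σ * (1 - v))
  rw [show -(σ * (1 - v)) = σ * (v - 1) by ring] at h1
  have hy1 : Real.exp (σ * (v - 1)) ≤ 1 := Real.exp_le_one_iff.2 (by nlinarith)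
  set y := Real.exp (σ * (v - 1))
  have hx : 0 ≤ σ * (1 - v) := mul_nonneg hσ.le (by linarith)
  -- With `σ (1 - v) = -log y`, this is `-y log y ≤ 1 - y` combined with `η ≤ y`.
  have h2 : η * (σ * (1 - v)) ≤ 1 - y := by nlinarith
  have h3 : 2 * (Real.cosh σ - d) * (Real.exp σ - Real.exp σ * y) ≤
      Real.exp σ ^ 2 * (Real.pi / σ) * (1 - y) := by
    have : 2 * (Real.cosh σ - d) ≤ Real.pi * Real.exp σ / σ := by
      rw [le_div_iff₀ hσ]; linarith
    calc _ = 2 * (Real.cosh σ - d) * (Real.exp σ * (1 - y)) := by ring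
      _ ≤ Real.pi * Real.exp σ / σ * (Real.exp σ * (1 - y)) :=
        mul_le_mul_of_nonneg_right this (mul_nonneg hs.le (by linarith))
      _ = _ := by ring
  have h4 : 2 * d * Real.sinh σ * (1 - v) ≤ Real.exp σ ^ 2 * (1 / (η * σ)) * (1 - y) := by
    have hdS : 2 * d * Real.sinh σ ≤ Real.exp σ ^ 2 := by
      have := mul_le_mul_of_nonneg_right hd' hS.le
      rw [← Real.cosh_add_sinh]
      nlinarith [sq_nonneg (Real.cosh σ), sq_nonneg (Real.sinh σ)]
    calc 2 * d * Real.sinh σ * (1 - v) ≤ Real.exp σ ^ 2 * (1 - v) :=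
          mul_le_mul_of_nonneg_right hdS (by linarith)
      _ = Real.exp σ ^ 2 * (1 / (η * σ)) * (η * (σ * (1 - v))) := by field_simp
      _ ≤ _ := mul_le_mul_of_nonneg_left h2 (by positivity)
  have h5 : Real.exp σ ^ 2 * (Real.pi / σ + 1 / (η * σ)) * (1 - y) ≤
      Real.exp σ ^ 2 * (Real.pi / σ + 1 / (η * σ)) * (1 - y ^ 2) := by
    have := Real.pi_pos
    have hy := Real.exp_pos (σ * (v - 1))
    exact mul_le_mul_of_nonneg_left (by nlinarith) (by positivity)
  linarith

/-- Normalise the maximum of `y` to `1` and split where `y = η`. Above `η`, `y'² ≥ (1 - μ)(1 - y²)`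
with `μ = π/σ + 1/(ησ)`, so at most a quarter oscillation `π/2` is used, up to the factor `1/√(1 -
μ)`. Below `η`, `y'² ≥ (1 - η)(y - e^{-2σ})` makes the remaining angle of order `√η`. -/
theorem halfTurn_le {σ d η : ℝ} (hσ : 0 < σ) (hd : 0 ≤ d) (hd' : d ≤ Real.cosh σ)
    (h0 : areaIntegral σ d = 0) (hη : 0 < η) (hη' : η < 1) (hσ' : Real.exp (-(2 * σ)) < η)
    (hμ : Real.pi / σ + 1 / (η * σ) < 1) :
    halfTurn σ d ≤ Real.pi / 2 / √(1 - (Real.pi / σ + 1 / (η * σ))) + 2 * √η / √(1 - η) := by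
  have i := continuous_div_sqrt_weight hσ hd (f := fun φ => Real.exp (σ * Real.cos φ)) (by fun_prop)
  have hc := supportCenter_le hσ hd hd' h0
  have hs := Real.exp_pos σ
  set k := 1 - (Real.pi / σ + 1 / (η * σ)) with hk
  have hk0 : 0 < k := by linarith
  have hk1 := Real.sqrt_pos.2 hk0
  have hη1 : 0 < 1 - η := by linarith
  have hη2 := Real.sqrt_pos.2 hη1
  have hlog : -(2 * σ) < Real.log η := (Real.lt_log_iff_exp_lt hη).2 hσ'
  have hlog' : Real.log η < 0 := Real.log_neg hη hη'
  have hv1 : -1 < 1 + Real.log η / σ := by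
    have : -2 < Real.log η / σ := by rw [lt_div_iff₀ hσ]; linarith
    linarith
  have hv2 : 1 + Real.log η / σ < 1 := by
    have : Real.log η / σ < 0 := div_neg_of_neg_of_pos hlog' hσ
    linarith
  -- The parameter at which `e^{σ (cos φ - 1)} = η`.
  set φ₁ := Real.arccos (1 + Real.log η / σ) with hφ₁
  have hcos : Real.cos φ₁ = 1 + Real.log η / σ := Real.cos_arccos hv1.le hv2.le
  have hφ₁0 : 0 ≤ φ₁ := Real.arccos_nonneg _
  have hφ₁π : φ₁ ≤ Real.pi := Real.arccos_le_pi _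
  have hyη : Real.exp (σ * (Real.cos φ₁ - 1)) = η := by
    rw [hcos, show σ * (1 + Real.log η / σ - 1) = Real.log η by field_simp; ring, Real.exp_log hη]
  have hder : ∀ φ, HasDerivAt (fun φ => Real.exp (σ * (Real.cos φ - 1)))
      (-(σ * Real.sin φ * Real.exp (σ * (Real.cos φ - 1)))) φ := by
    intro φ
    convert (((Real.hasDerivAt_cos φ).sub_const 1).const_mul σ).exp using 1
    ring
  have he : ∀ φ, Real.exp (σ * Real.cos φ) = Real.exp σ * Real.exp (σ * (Real.cos φ - 1)) := by
    intro φ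
    rw [← Real.exp_add]; ring_nf
  have first : ∫ φ in (0 : ℝ)..φ₁, Real.exp (σ * Real.cos φ) / √(weight σ d (Real.cos φ)) ≤
      Real.pi / 2 / √k := by
    have h := intervalIntegral.integral_le_sub_of_hasDeriv_right_of_le
      (g := fun φ => Real.arccos (Real.exp (σ * (Real.cos φ - 1))) / √k)
      (g' := fun φ => σ * Real.sin φ * Real.exp (σ * (Real.cos φ - 1)) /
        √(1 - Real.exp (σ * (Real.cos φ - 1)) ^ 2) / √k)
      (φ := fun φ => Real.exp (σ * Real.cos φ) / √(weight σ d (Real.cos φ)))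
      hφ₁0 ?_ ?_ (i.continuousOn.integrableOn_Icc) ?_
    · refine h.trans ?_
      simp only [hyη, Real.cos_zero, sub_self, mul_zero, Real.exp_zero, Real.arccos_one, zero_div,
        sub_zero]
      gcongr
      exact Real.arccos_le_pi_div_two.2 hη.le
    · exact ((Real.continuous_arccos.comp (by fun_prop)).div_const _).continuousOn
    · intro φ hφ
      have hφ' : φ ∈ Set.Ioo 0 Real.pi := ⟨hφ.1, hφ.2.trans_le hφ₁π⟩
      have hy1 : Real.exp (σ * (Real.cos φ - 1)) < 1 :=
        Real.exp_lt_one_iff.2 (by nlinarith [(cos_mem_Ioo hφ').2])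
      have hy0 := Real.exp_pos (σ * (Real.cos φ - 1))
      have ha := ((Real.hasDerivAt_arccos (by linarith) hy1.ne).comp φ (hder φ)).div_const (√k)
      refine (ha.congr_deriv ?_).hasDerivWithinAt
      ring
    · intro φ hφ
      have hφ' : φ ∈ Set.Ioo 0 Real.pi := ⟨hφ.1, hφ.2.trans_le hφ₁π⟩
      have hy1 : Real.exp (σ * (Real.cos φ - 1)) < 1 :=
        Real.exp_lt_one_iff.2 (by nlinarith [(cos_mem_Ioo hφ').2])
      have hy0 := Real.exp_pos (σ * (Real.cos φ - 1))
      have hηy : η ≤ Real.exp (σ * (Real.cos φ - 1)) := by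
        rw [← hyη]
        have := Real.cos_le_cos_of_nonneg_of_le_pi hφ.1.le hφ₁π hφ.2.le
        exact Real.exp_le_exp.2 (by nlinarith)
      have hw := sqrt_weight_mul (d := d) hσ hφ'
      have hl := Real.sqrt_le_sqrt
        (le_weight_of_le_exp hσ hd' hc (Real.cos_le_one φ) hη hηy)
      rw [← hw, ← hk, Real.sqrt_mul (by positivity), Real.sqrt_mul (sq_nonneg _),
        Real.sqrt_sq hs.le] at hl
      have hr := Real.sqrt_pos.2 (weight_cos_pos hσ hd φ)
      have hq : 0 < √(1 - Real.exp (σ * (Real.cos φ - 1)) ^ 2) :=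
        Real.sqrt_pos.2 (by nlinarith)
      rw [he, div_div, div_le_div_iff₀ hr (by positivity)]
      nlinarith
  have second : ∫ φ in φ₁..Real.pi, Real.exp (σ * Real.cos φ) / √(weight σ d (Real.cos φ)) ≤
      2 * √η / √(1 - η) := by
    have h := intervalIntegral.integral_le_sub_of_hasDeriv_right_of_le
      (g := fun φ => -(2 * √(Real.exp (σ * (Real.cos φ - 1)) - Real.exp (-(2 * σ))) / √(1 - η)))
      (g' := fun φ => σ * Real.sin φ * Real.exp (σ * (Real.cos φ - 1)) /
        √(Real.exp (σ * (Real.cos φ - 1)) - Real.exp (-(2 * σ))) / √(1 - η))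
      (φ := fun φ => Real.exp (σ * Real.cos φ) / √(weight σ d (Real.cos φ)))
      hφ₁π ?_ ?_ (i.continuousOn.integrableOn_Icc) ?_
    · refine h.trans ?_
      simp only [hyη, Real.cos_pi]
      rw [show σ * (-1 - 1) = -(2 * σ) by ring, sub_self, Real.sqrt_zero, mul_zero, zero_div,
        neg_zero, zero_sub, neg_neg]
      gcongr
      linarith [Real.exp_pos (-(2 * σ))]
    · exact Continuous.continuousOn (by fun_prop)
    · intro φ hφ
      have hφ' : φ ∈ Set.Ioo 0 Real.pi := ⟨hφ₁0.trans_lt hφ.1, hφ.2⟩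
      have hy : 0 < Real.exp (σ * (Real.cos φ - 1)) - Real.exp (-(2 * σ)) :=
        sub_pos.2 (Real.exp_lt_exp.2 (by nlinarith [(cos_mem_Ioo hφ').1]))
      have ha := ((((hder φ).sub_const (Real.exp (-(2 * σ)))).sqrt hy.ne').const_mul 2).div_const
        (√(1 - η)) |>.neg
      refine (ha.congr_deriv ?_).hasDerivWithinAt
      have := Real.sqrt_pos.2 hy
      field_simp
    · intro φ hφ
      have hφ' : φ ∈ Set.Ioo 0 Real.pi := ⟨hφ₁0.trans_lt hφ.1, hφ.2⟩
      have hy : 0 < Real.exp (σ * (Real.cos φ - 1)) - Real.exp (-(2 * σ)) :=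
        sub_pos.2 (Real.exp_lt_exp.2 (by nlinarith [(cos_mem_Ioo hφ').1]))
      have hyη' : Real.exp (σ * (Real.cos φ - 1)) ≤ η := by
        rw [← hyη]
        have := Real.cos_le_cos_of_nonneg_of_le_pi hφ₁0 hφ.2.le hφ.1.le
        exact Real.exp_le_exp.2 (by nlinarith)
      have hw := sqrt_weight_mul (d := d) hσ hφ'
      have hg := exp_mul_le_chord hσ (Real.neg_one_le_cos φ) (Real.cos_le_one φ)
      have es : Real.exp (-σ) = Real.exp σ * Real.exp (-(2 * σ)) := by
        rw [← Real.exp_add]; ring_nf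
      have hl : Real.exp σ ^ 2 * (Real.exp (σ * (Real.cos φ - 1)) - Real.exp (-(2 * σ))) *
          (1 - η) ≤
          (Real.exp (σ * Real.cos φ) - Real.exp (-σ)) * (Real.exp σ - Real.exp (σ * Real.cos φ)) +
        2 * d * (Real.cosh σ + Real.cos φ * Real.sinh σ - Real.exp (σ * Real.cos φ)) := by
        -- Near the minimum the chord term only helps and is dropped.
        have h1 : 0 ≤ 2 * d * (Real.cosh σ + Real.cos φ * Real.sinh σ -
          Real.exp (σ * Real.cos φ)) := mul_nonneg (by linarith) (by linarith)
        have h2 : Real.exp σ ^ 2 * (Real.exp (σ * (Real.cos φ - 1)) - Real.exp (-(2 * σ))) *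
          (1 - η) ≤ Real.exp σ ^ 2 * (Real.exp (σ * (Real.cos φ - 1)) - Real.exp (-(2 * σ))) *
          (1 - Real.exp (σ * (Real.cos φ - 1))) :=
          mul_le_mul_of_nonneg_left (by linarith) (by positivity)
        rw [es]
        rw [he] at h1 ⊢
        linarith
      replace hl := Real.sqrt_le_sqrt hl
      rw [← hw, Real.sqrt_mul (by positivity), Real.sqrt_mul (sq_nonneg _),
        Real.sqrt_sq hs.le] at hl
      have hr := Real.sqrt_pos.2 (weight_cos_pos hσ hd φ)
      have hq := Real.sqrt_pos.2 hy
      have hy0 := Real.exp_pos (σ * (Real.cos φ - 1))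
      rw [he, div_div, div_le_div_iff₀ hr (by positivity)]
      nlinarith
  rw [halfTurn, ← intervalIntegral.integral_add_adjacent_intervals
    (i.intervalIntegrable 0 φ₁) (i.intervalIntegrable _ _)]
  linarith

theorem eventually_halfTurn_lt {τ : ℝ} (hτ : Real.pi / 2 < τ) :
    ∀ᶠ σ in Filter.atTop, ∀ d, 0 ≤ d → d ≤ Real.cosh σ → areaIntegral σ d = 0 →
      halfTurn σ d < τ := by
  -- The cutoff must be fixed before `σ → ∞`, since the error contains `1/(ησ)`.
  obtain ⟨η, hη, hη', hητ⟩ : ∃ η : ℝ, 0 < η ∧ η < 1 ∧ Real.pi / 2 + 2 * √η / √(1 - η) < τ := by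
    have hc : ContinuousAt (fun η : ℝ => Real.pi / 2 + 2 * √η / √(1 - η)) 0 :=
      continuousAt_const.add (ContinuousAt.div (by fun_prop) (by fun_prop) (by simp))
    have h : ∀ᶠ η : ℝ in nhdsWithin 0 (Set.Ioi 0), Real.pi / 2 + 2 * √η / √(1 - η) < τ :=
      nhdsWithin_le_nhds (hc.eventually_lt_const (by simpa using hτ))
    have h1 : ∀ᶠ η : ℝ in nhdsWithin 0 (Set.Ioi 0), η < 1 :=
      nhdsWithin_le_nhds (gt_mem_nhds one_pos)
    obtain ⟨η, ⟨h2, h3⟩, h4⟩ := ((h.and h1).and self_mem_nhdsWithin).exists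
    exact ⟨η, h4, h3, h2⟩
  have t1 : Filter.Tendsto (fun σ : ℝ => Real.pi / σ + 1 / (η * σ)) Filter.atTop (nhds 0) := by
    have h1 : Filter.Tendsto (fun σ : ℝ => Real.pi / σ) Filter.atTop (nhds 0) :=
      Filter.Tendsto.const_div_atTop Filter.tendsto_id _
    have h2 : Filter.Tendsto (fun σ : ℝ => 1 / (η * σ)) Filter.atTop (nhds 0) :=
      Filter.Tendsto.const_div_atTop (Filter.tendsto_id.const_mul_atTop hη) _
    simpa using h1.add h2
  have t2 : Filter.Tendsto (fun σ : ℝ => Real.pi / 2 / √(1 - (Real.pi / σ + 1 / (η * σ))) +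
      2 * √η / √(1 - η)) Filter.atTop (nhds (Real.pi / 2 + 2 * √η / √(1 - η))) := by
    have hc : ContinuousAt (fun μ : ℝ => Real.pi / 2 / √(1 - μ) + 2 * √η / √(1 - η)) 0 :=
      (ContinuousAt.div (by fun_prop) (by fun_prop) (by simp)).add continuousAt_const
    simpa [Function.comp_def] using hc.tendsto.comp t1
  have t3 : Filter.Tendsto (fun σ : ℝ => Real.exp (-(2 * σ))) Filter.atTop (nhds 0) :=
    Real.tendsto_exp_neg_atTop_nhds_zero.comp (Filter.tendsto_id.const_mul_atTop two_pos)
  filter_upwards [t2.eventually (gt_mem_nhds hητ), t1.eventually (gt_mem_nhds one_pos),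
    t3.eventually (gt_mem_nhds hη), Filter.eventually_gt_atTop 0] with σ h1 h2 h3 hσ d hd hd' h0
  exact (halfTurn_le hσ hd hd' h0 hη hη' h3 h2).trans_lt h1

theorem exists_halfTurn_eq {τ : ℝ} (hτ : Real.pi / 2 < τ) (hτ' : τ < Real.pi) :
    ∃ σ d, 0 < σ ∧ 0 < d ∧ d < Real.sinh σ ∧ areaIntegral σ d = 0 ∧ halfTurn σ d = τ := by
  choose! d hd using fun σ (hσ : 0 < σ) => exists_areaIntegral_eq_zero hσ
  have hc : ContinuousOn (fun σ => halfTurn σ (d σ)) (Set.Ioi 0) :=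
    continuousOn_halfTurn.comp (f := fun σ => (σ, d σ))
      (continuousOn_id.prodMk (continuousOn_of_areaIntegral_eq_zero (fun σ hσ => (hd σ hσ).1)
        fun σ hσ => (hd σ hσ).2.2)) fun σ hσ => ⟨hσ, (hd σ hσ).1.le⟩
  obtain ⟨a, ha, ha0⟩ := ((eventually_lt_halfTurn hτ').and self_mem_nhdsWithin).exists
  obtain ⟨b, hb, hb0⟩ := ((eventually_halfTurn_lt hτ).and (Filter.eventually_gt_atTop 0)).exists
  have ha0 : 0 < a := ha0
  have hda := hd a ha0
  have hdb := hd b hb0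
  have h1 := ha (d a) hda.1.le hda.2.1.le
  have h2 := hb (d b) hdb.1.le (hdb.2.1.trans (Real.sinh_lt_cosh b)).le hdb.2.2
  obtain ⟨σ, hσ, h⟩ := isPreconnected_Ioi.intermediate_value (Set.mem_Ioi.2 hb0)
    (Set.mem_Ioi.2 ha0) hc ⟨h2.le, h1.le⟩
  exact ⟨σ, d σ, hσ, (hd σ hσ).1, (hd σ hσ).2.1, (hd σ hσ).2.2, h⟩

/-! ### Curves given by speed and tangent angle -/

theorem inner_mul_exp (a b : ℂ) (t : ℝ) :
    inner ℝ (a * Complex.exp (t * Complex.I)) (b * Complex.exp (t * Complex.I)) = inner ℝ a b := by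
  have h : Complex.normSq (Complex.exp (t * Complex.I)) = 1 := by
    rw [Complex.normSq_eq_norm_sq, Complex.norm_exp_ofReal_mul_I, one_pow]
  rw [Complex.inner, Complex.inner, map_mul]
  have : b * Complex.exp (t * Complex.I) *
      ((starRingEnd ℂ) a * (starRingEnd ℂ) (Complex.exp (t * Complex.I))) =
      b * (starRingEnd ℂ) a *
        ((starRingEnd ℂ) (Complex.exp (t * Complex.I)) * Complex.exp (t * Complex.I)) := by ring
  rw [this, ← Complex.normSq_eq_conj_mul_self, h]
  simp

section SpeedAngle

variable {x : ℝ → ℂ} {ρ θ : ℝ → ℝ}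

theorem norm_deriv_of_hasDerivAt
    (hx : ∀ u, HasDerivAt x (ρ u * Complex.exp (θ u * Complex.I)) u) (hρ : ∀ u, 0 < ρ u) (u : ℝ) :
    ‖deriv x u‖ = ρ u := by
  rw [(hx u).deriv, norm_mul, Complex.norm_exp_ofReal_mul_I, mul_one, Complex.norm_real,
    Real.norm_of_nonneg (hρ u).le]

theorem tangent_of_hasDerivAt
    (hx : ∀ u, HasDerivAt x (ρ u * Complex.exp (θ u * Complex.I)) u) (hρ : ∀ u, 0 < ρ u) (u : ℝ) :
    tangent x u = Complex.exp (θ u * Complex.I) := by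
  have : (ρ u : ℂ) ≠ 0 := Complex.ofReal_ne_zero.2 (hρ u).ne'
  rw [tangent, norm_deriv_of_hasDerivAt hx hρ, (hx u).deriv]
  field_simp

theorem normal_of_hasDerivAt
    (hx : ∀ u, HasDerivAt x (ρ u * Complex.exp (θ u * Complex.I)) u) (hρ : ∀ u, 0 < ρ u) (u : ℝ) :
    normal x u = Complex.I * Complex.exp (θ u * Complex.I) := by
  rw [normal, tangent_of_hasDerivAt hx hρ]

theorem curvature_of_hasDerivAt
    (hx : ∀ u, HasDerivAt x (ρ u * Complex.exp (θ u * Complex.I)) u) (hρ : ∀ u, 0 < ρ u)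
    (hρd : Differentiable ℝ ρ) {θ' : ℝ → ℝ} (hθ : ∀ u, HasDerivAt θ (θ' u) u) (u : ℝ) :
    curvature x u = θ' u / ρ u := by
  have hd : deriv x = fun u => ρ u * Complex.exp (θ u * Complex.I) :=
    funext fun u => (hx u).deriv
  have h2 : HasDerivAt (fun u => (ρ u : ℂ) * Complex.exp (θ u * Complex.I))
      (((deriv ρ u : ℝ) + ρ u * θ' u * Complex.I : ℂ) * Complex.exp (θ u * Complex.I)) u := by
    refine ((hρd u).hasDerivAt.ofReal_comp.mul
      ((hθ u).ofReal_comp.mul_const Complex.I).cexp).congr_deriv ?_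
    ring
  rw [curvature, norm_deriv_of_hasDerivAt hx hρ, normal_of_hasDerivAt hx hρ, hd, h2.deriv,
    inner_mul_exp, Complex.inner]
  have := hρ u
  simp
  field_simp

end SpeedAngle

/-! ### The curve -/

/-- The tangent angle of the curve. -/
def tangentAngle (σ d φ : ℝ) : ℝ :=
  ∫ t in (0 : ℝ)..φ, Real.exp (σ * Real.cos t) / √(weight σ d (Real.cos t))

/-- The curve with support function `exp (σ * cos φ) - (cosh σ - d)` and tangent angle
`tangentAngle σ d φ`. -/
def supportCurve (σ d φ : ℝ) : ℂ :=
  (((-(σ * Real.sin φ * √(weight σ d (Real.cos φ))) : ℝ) : ℂ) -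
    ((Real.exp (σ * Real.cos φ) - (Real.cosh σ - d) : ℝ) : ℂ) * Complex.I) *
    Complex.exp (tangentAngle σ d φ * Complex.I)

section Curve

variable {σ d : ℝ}

theorem contDiff_sqrt_weight (hσ : 0 < σ) (hd : 0 ≤ d) :
    ContDiff ℝ ∞ fun φ => √(weight σ d (Real.cos φ)) :=
  ((contDiff_weight σ d).comp Real.contDiff_cos).sqrt fun φ => (weight_cos_pos hσ hd φ).ne'

theorem sqrt_weight_pos (hσ : 0 < σ) (hd : 0 ≤ d) (φ : ℝ) : 0 < √(weight σ d (Real.cos φ)) :=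
  Real.sqrt_pos.2 (weight_cos_pos hσ hd φ)

theorem hasDerivAt_tangentAngle (hσ : 0 < σ) (hd : 0 ≤ d) (φ : ℝ) :
    HasDerivAt (tangentAngle σ d) (Real.exp (σ * Real.cos φ) / √(weight σ d (Real.cos φ))) φ := by
  have i := continuous_div_sqrt_weight hσ hd (f := fun φ => Real.exp (σ * Real.cos φ)) (by fun_prop)
  exact intervalIntegral.integral_hasDerivAt_right (i.intervalIntegrable _ _)
    (i.stronglyMeasurableAtFilter _ _) i.continuousAt

theorem contDiff_tangentAngle (hσ : 0 < σ) (hd : 0 ≤ d) : ContDiff ℝ ∞ (tangentAngle σ d) := by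
  refine contDiff_infty_iff_deriv.2
    ⟨fun φ => (hasDerivAt_tangentAngle hσ hd φ).differentiableAt, ?_⟩
  rw [funext fun φ => (hasDerivAt_tangentAngle hσ hd φ).deriv]
  exact ContDiff.div (by fun_prop) (contDiff_sqrt_weight hσ hd)
    fun φ => (sqrt_weight_pos hσ hd φ).ne'

theorem contDiff_supportCurve (hσ : 0 < σ) (hd : 0 ≤ d) : ContDiff ℝ ∞ (supportCurve σ d) := by
  have h1 := contDiff_sqrt_weight hσ hd
  have h2 := contDiff_tangentAngle hσ hd
  have h3 : ContDiff ℝ ∞ fun φ => -(σ * Real.sin φ * √(weight σ d (Real.cos φ))) := by fun_prop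
  have h4 : ContDiff ℝ ∞ fun φ => Real.exp (σ * Real.cos φ) - (Real.cosh σ - d) := by fun_prop
  refine ContDiff.mul ((Complex.ofRealCLM.contDiff.comp h3).sub
    ((Complex.ofRealCLM.contDiff.comp h4).mul contDiff_const)) ?_
  exact ((Complex.ofRealCLM.contDiff.comp h2).mul contDiff_const).cexp

theorem dense_sin_ne_zero : Dense {φ : ℝ | Real.sin φ ≠ 0} := by
  have : {φ : ℝ | Real.sin φ = 0}.Countable := by
    refine (Set.countable_range fun k : ℤ => (k : ℝ) * Real.pi).mono fun φ hφ => ?_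
    exact Real.sin_eq_zero_iff.1 hφ
  exact this.dense_compl ℝ

/-- The derivative of the support function with respect to the tangent angle satisfies the
oscillator equation. -/
theorem hasDerivAt_sin_mul_sqrt_weight (hσ : 0 < σ) (hd : 0 ≤ d) (φ : ℝ) :
    HasDerivAt (fun φ => -(σ * Real.sin φ * √(weight σ d (Real.cos φ))))
      ((Real.exp (σ * Real.cos φ) * (Real.cosh σ - d - Real.exp (σ * Real.cos φ)) +
        d * Real.sinh σ / σ) / √(weight σ d (Real.cos φ))) φ := by
  have h1 := contDiff_sqrt_weight hσ hd
  set g : ℝ → ℝ := fun φ => -(σ * Real.sin φ * √(weight σ d (Real.cos φ))) with hg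
  have hgs : ContDiff ℝ ∞ g := by fun_prop
  have hgd : ∀ φ, HasDerivAt g (deriv g φ) φ := fun φ =>
    (hgs.differentiable (by simp) φ).hasDerivAt
  suffices h : deriv g = fun φ =>
      ((Real.exp (σ * Real.cos φ) * (Real.cosh σ - d - Real.exp (σ * Real.cos φ)) +
        d * Real.sinh σ / σ) / √(weight σ d (Real.cos φ))) by
    have := hgd φ
    rwa [h] at this
  -- Differentiating the first integral determines `2 g g'`. Division by `g` is possible only where
  -- `sin φ ≠ 0`; continuity covers the remaining points.
  refine Continuous.ext_on dense_sin_ne_zero (hgs.continuous_deriv (by simp))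
    (continuous_div_sqrt_weight hσ hd (by fun_prop)) fun φ hφ => ?_
  have hφ : Real.sin φ ≠ 0 := hφ
  have hsq : (fun φ => g φ ^ 2) = fun φ =>
      (Real.exp (σ * Real.cos φ) - Real.exp (-σ)) * (Real.exp σ - Real.exp (σ * Real.cos φ)) +
        2 * d * (Real.cosh σ + Real.cos φ * Real.sinh σ - Real.exp (σ * Real.cos φ)) := by
    funext φ
    rw [← weight_mul hσ.ne', ← Real.sin_sq, hg]
    have := Real.sq_sqrt (weight_cos_pos hσ hd φ).le
    linear_combination σ ^ 2 * Real.sin φ ^ 2 * this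
  have d1 : HasDerivAt (fun φ => g φ ^ 2) (2 * g φ * deriv g φ) φ := by
    simpa using (hgd φ).fun_pow 2
  have he := hasDerivAt_exp_mul_cos σ φ
  have d2 := ((he.sub_const (Real.exp (-σ))).mul (he.const_sub (Real.exp σ))).add
    ((((Real.hasDerivAt_cos φ).mul_const (Real.sinh σ)).const_add (Real.cosh σ)).sub he
      |>.const_mul (2 * d))
  have hkey : 2 * g φ * deriv g φ =
      -(2 * σ * Real.sin φ * (Real.exp (σ * Real.cos φ) *
        (Real.cosh σ - d - Real.exp (σ * Real.cos φ)) + d * Real.sinh σ / σ)) := by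
    have h := d1.unique (HasDerivAt.congr_of_eventuallyEq d2 (Filter.Eventually.of_forall
      fun φ => congrFun hsq φ))
    rw [h, ← Real.cosh_sub_sinh σ, ← Real.cosh_add_sinh σ]
    field_simp
    ring
  have hr := sqrt_weight_pos hσ hd φ
  rw [eq_div_iff hr.ne']
  rw [hg] at hkey
  refine mul_left_cancel₀ (mul_ne_zero (mul_ne_zero two_ne_zero hσ.ne') hφ) ?_
  linear_combination -hkey

/-- The curve is `h' T - h N`, with `'` the derivative in `θ`. Its normal derivative cancels and the
tangential one is `(h'' + h) dθ/dφ`. -/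
theorem hasDerivAt_supportCurve (hσ : 0 < σ) (hd : 0 ≤ d) (φ : ℝ) :
    HasDerivAt (supportCurve σ d) (((d * Real.sinh σ / σ) / √(weight σ d (Real.cos φ)) : ℝ) *
      Complex.exp (tangentAngle σ d φ * Complex.I)) φ := by
  have h1 := (hasDerivAt_sin_mul_sqrt_weight hσ hd φ).ofReal_comp
  have h2 := ((hasDerivAt_exp_mul_cos σ φ).sub_const (Real.cosh σ - d)).ofReal_comp.mul_const
    Complex.I
  have h3 := ((hasDerivAt_tangentAngle hσ hd φ).ofReal_comp.mul_const Complex.I).cexp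
  refine ((h1.fun_sub h2).fun_mul h3).congr_deriv ?_
  have hr : (√(weight σ d (Real.cos φ)) : ℂ) ≠ 0 :=
    Complex.ofReal_ne_zero.2 (sqrt_weight_pos hσ hd φ).ne'
  push_cast
  field_simp
  ring_nf
  simp only [Complex.I_sq]
  ring

/-- In `h² + h'²` the first integral cancels all terms in `y` except the logarithmic one, which is
linear in `cos φ`. -/
theorem norm_sq_supportCurve (hσ : 0 < σ) (hd : 0 ≤ d) (φ : ℝ) :
    ‖supportCurve σ d φ‖ ^ 2 = (Real.cosh σ - d) ^ 2 - 1 + 2 * d * Real.cosh σ +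
      2 * d * Real.sinh σ * Real.cos φ := by
  rw [supportCurve, norm_mul, Complex.norm_exp_ofReal_mul_I, mul_one, ← Complex.normSq_eq_norm_sq,
    Complex.normSq_apply]
  have h := weight_mul hσ.ne' d (Real.cos φ)
  rw [← Real.sin_sq] at h
  have hr := Real.sq_sqrt (weight_cos_pos hσ hd φ).le
  rw [← Real.cosh_sub_sinh σ, ← Real.cosh_add_sinh σ] at h
  simp only [Complex.sub_re, Complex.ofReal_re, Complex.mul_re, Complex.I_re, mul_zero,
    Complex.ofReal_im, Complex.I_im, mul_one, sub_self, sub_zero, Complex.sub_im, Complex.mul_im,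
    zero_sub, add_zero]
  linear_combination h + σ ^ 2 * Real.sin φ ^ 2 * hr - Real.cosh_sq σ

end Curve

/-! ### Shrinkers from `λ`-curves -/

section Homothety

variable (x : ℝ → ℂ) (p : ℂ) {r : ℝ}

theorem deriv_homothety (r : ℝ) : deriv (fun u => p + r * (x u - p)) = fun u => r * deriv x u := by
  funext u
  rw [deriv_const_add, deriv_const_mul_field, deriv_sub_const]

theorem norm_deriv_homothety (hr : 0 < r) (u : ℝ) :
    ‖deriv (fun u => p + r * (x u - p)) u‖ = r * ‖deriv x u‖ := by
  rw [deriv_homothety, norm_mul, Complex.norm_real, Real.norm_of_nonneg hr.le]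

theorem normal_homothety (hr : 0 < r) :
    normal (fun u => p + r * (x u - p)) = normal x := by
  funext u
  have : (r : ℂ) ≠ 0 := Complex.ofReal_ne_zero.2 hr.ne'
  rw [normal, normal, tangent, tangent, norm_deriv_homothety x p hr, deriv_homothety]
  push_cast
  rw [mul_div_mul_left _ _ this]

theorem curvature_homothety (hr : 0 < r) (u : ℝ) :
    curvature (fun u => p + r * (x u - p)) u = curvature x u / r := by
  rw [curvature, curvature, norm_deriv_homothety x p hr, normal_homothety x p hr, deriv_homothety,
    deriv_const_mul_field, ← Complex.real_smul, real_inner_smul_left]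
  field_simp

theorem avgCurvature_homothety (hr : 0 < r) :
    avgCurvature (fun u => p + r * (x u - p)) = avgCurvature x / r := by
  have h1 : length (fun u => p + r * (x u - p)) = r * length x := by
    simp only [length, norm_deriv_homothety x p hr, intervalIntegral.integral_const_mul]
  have h2 : ∀ u, curvature x u / r * (r * ‖deriv x u‖) = curvature x u * ‖deriv x u‖ := fun u => by
    field_simp
  simp only [avgCurvature, h1, norm_deriv_homothety x p hr, curvature_homothety x p hr, h2]
  field_simp

end Homothety

theorem IsClosedImmersion.homothety {x : ℝ → ℂ} (hx : IsClosedImmersion x) (p : ℂ) {r : ℝ}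
    (hr : 0 < r) : IsClosedImmersion fun u => p + r * (x u - p) where
  smooth := contDiff_const.add (contDiff_const.mul (hx.smooth.sub contDiff_const))
  periodic u := by simp only [hx.periodic u]
  immersion u := by
    rw [deriv_homothety]
    exact mul_ne_zero (Complex.ofReal_ne_zero.2 hr.ne') (hx.immersion u)

/-- Under scaling by `ψ`, `k - k̄` becomes `(δ/ψ) ⟨x - p, -N⟩` and the normal velocity is `ψ' ⟨x -
p, N⟩`. Hence `ψ ψ' = -δ`, so `ψ = √(1 - 2δt)`, positive until `1/(2δ)`. -/
theorem IsLambdaCurve.isAPCSFShrinker {x : ℝ → ℂ} (hx : IsClosedImmersion x)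
    (h : IsLambdaCurve (avgCurvature x) x) : IsAPCSFShrinker x := by
  obtain ⟨δ, p, hδ, hκ⟩ := h
  have hpos : ∀ t ∈ Set.Ico 0 (1 / (2 * δ)), 0 < 1 - 2 * δ * t := fun t ht => by
    have := (lt_div_iff₀ (by positivity)).1 ht.2
    linarith
  have hψ0 : ∀ t ∈ Set.Ico 0 (1 / (2 * δ)), 0 < √(1 - 2 * δ * t) :=
    fun t ht => Real.sqrt_pos.2 (hpos t ht)
  have hder : ∀ t ∈ Set.Ico 0 (1 / (2 * δ)),
      HasDerivAt (fun t => √(1 - 2 * δ * t)) (-δ / √(1 - 2 * δ * t)) t := fun t ht => by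
    refine ((((hasDerivAt_id t).const_mul (2 * δ)).const_sub 1).sqrt (hpos t ht).ne').congr_deriv ?_
    have := hψ0 t ht
    simp only [id]
    field_simp
  have hT : 0 < 1 / (2 * δ) := by positivity
  refine ⟨1 / (2 * δ), fun t u => p + (√(1 - 2 * δ * t) : ℝ) * (x u - p),
    fun t => √(1 - 2 * δ * t), p, hT, ⟨?_, ?_, ?_⟩, ?_, ⟨?_, ?_, ?_⟩, ?_⟩
  · have h1 : ContDiffOn ℝ ∞ (fun z : ℝ × ℝ => √(1 - 2 * δ * z.1))
        (Set.Ico 0 (1 / (2 * δ)) ×ˢ Set.univ) :=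
      ContDiffOn.sqrt (by fun_prop) fun z hz => (hpos z.1 hz.1).ne'
    refine contDiffOn_const.add ((Complex.ofRealCLM.contDiff.comp_contDiffOn h1).mul ?_)
    exact ((hx.smooth.comp contDiff_snd).sub contDiff_const).contDiffOn
  · exact fun t ht => hx.homothety p (hψ0 t ht)
  · intro t ht u
    have hr := hψ0 t ht
    have hd : HasDerivAt (fun s : ℝ => p + (√(1 - 2 * δ * s) : ℝ) * (x u - p))
        ((-δ / √(1 - 2 * δ * t) : ℝ) * (x u - p)) t :=
      ((hder t ht).ofReal_comp.mul_const _).const_add p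
    rw [hd.hasDerivWithinAt.derivWithin (uniqueDiffOn_Ico _ _ t ht), normal_homothety x p hr,
      curvature_homothety x p hr, avgCurvature_homothety x p hr, ← Complex.real_smul,
      real_inner_smul_left, hκ u, inner_neg_right]
    ring
  · funext u
    simp
  · exact ContDiffOn.sqrt (by fun_prop) fun t ht => (hpos t ht).ne'
  · refine Or.inr fun s _ t _ hst => Real.sqrt_le_sqrt ?_
    nlinarith
  · intro t _ u
    simp
  · intro t ht
    rw [(hder t ht).hasDerivWithinAt.derivWithin (uniqueDiffOn_Ico _ _ t ht)]
    exact div_nonpos_of_nonpos_of_nonneg (by linarith) (hψ0 t ht).le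

/-! ### Circles have constant curvature -/

/-- Differentiating `|x - c|² = r²` twice gives `x - c` normal and `κ ⟨x - c, N⟩ = -1`. Squaring
removes the orientation. -/
theorem IsCircular.exists_curvature {x : ℝ → ℂ} {ρ θ θ' : ℝ → ℝ}
    (hx : ∀ u, HasDerivAt x (ρ u * Complex.exp (θ u * Complex.I)) u) (hρ : ∀ u, 0 < ρ u)
    (hρd : Differentiable ℝ ρ) (hθ : ∀ u, HasDerivAt θ (θ' u) u) (h : IsCircular x) :
    ∃ r : ℝ, ∀ u, (curvature x u * r) ^ 2 = 1 := by
  obtain ⟨c, r, hr⟩ := h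
  refine ⟨r, fun u => ?_⟩
  set E : ℝ → ℂ := fun u => Complex.exp (θ u * Complex.I) with hE
  have hEn : ∀ u, ‖E u‖ = 1 := fun u => Complex.norm_exp_ofReal_mul_I _
  have hEd : ∀ u, HasDerivAt E (θ' u * Complex.I * E u) u := fun u => by
    refine ((hθ u).ofReal_comp.mul_const Complex.I).cexp.congr_deriv ?_
    simp only [hE]; ring
  have h1 : ∀ u, inner ℝ (x u - c) (E u) = 0 := fun u => by
    have hd := ((hx u).sub_const c).norm_sq
    have hc : (fun u => ‖x u - c‖ ^ 2) = fun _ => r ^ 2 := funext fun u => by rw [hr]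
    rw [hc] at hd
    have := hd.unique (hasDerivAt_const u _)
    rw [← Complex.real_smul, real_inner_smul_right] at this
    have := (hρ u).ne'
    simp_all
  have h2 : inner ℝ (x u - c) (θ' u * Complex.I * E u) + ρ u = 0 := by
    have hd := ((hx u).sub_const c).inner ℝ (hEd u)
    have hc : (fun u => inner ℝ (x u - c) (E u)) = fun _ => (0 : ℝ) := funext h1
    rw [hc] at hd
    have := hd.unique (hasDerivAt_const u _)
    have e : inner ℝ ((ρ u : ℂ) * E u) (E u) = ρ u := by
      rw [← Complex.real_smul, real_inner_smul_left, real_inner_self_eq_norm_sq, hEn, one_pow,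
        mul_one]
    rwa [e] at this
  have h3 : ∀ z e : ℂ, ‖e‖ = 1 → inner ℝ z e = 0 → inner ℝ z (Complex.I * e) ^ 2 = ‖z‖ ^ 2 := by
    intro z e he hze
    rw [Complex.inner] at hze ⊢
    have he' : e.re * e.re + e.im * e.im = 1 := by
      rw [← Complex.normSq_apply, Complex.normSq_eq_norm_sq, he, one_pow]
    rw [← Complex.normSq_eq_norm_sq, Complex.normSq_apply]
    simp at hze ⊢
    linear_combination (z.re ^ 2 + z.im ^ 2) * he' - (e.re * z.re + e.im * z.im) * hze
  have h4 := h3 _ _ (hEn u) (h1 u)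
  rw [hr] at h4
  rw [mul_assoc, ← Complex.real_smul, real_inner_smul_right] at h2
  rw [curvature_of_hasDerivAt hx hρ hρd hθ, mul_pow, ← h4]
  have h5 : θ' u * inner ℝ (x u - c) (Complex.I * E u) = -ρ u := by linarith
  have := hρ u
  rw [← mul_pow, div_mul_eq_mul_div, h5, neg_div, div_self this.ne', neg_one_sq]

/-! ### Integrals over full periods -/

theorem integral_two_pi_of_symm {h : ℝ → ℝ} (hc : Continuous h)
    (hs : ∀ t, h (2 * Real.pi - t) = h t) :
    ∫ t in (0 : ℝ)..(2 * Real.pi), h t = 2 * ∫ t in (0 : ℝ)..Real.pi, h t := by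
  have h1 : ∫ t in Real.pi..(2 * Real.pi), h t = ∫ t in (0 : ℝ)..Real.pi, h t := by
    have := intervalIntegral.integral_comp_sub_left h (2 * Real.pi) (a := 0) (b := Real.pi)
    rw [sub_zero, show 2 * Real.pi - Real.pi = Real.pi by ring] at this
    rw [← this]
    exact intervalIntegral.integral_congr fun t _ => hs t
  rw [← intervalIntegral.integral_add_adjacent_intervals (hc.intervalIntegrable 0 Real.pi)
    (hc.intervalIntegrable _ _), h1, two_mul]

theorem integral_comp_nat_mul {h : ℝ → ℝ} (hc : Continuous h)
    (hs : ∀ t, h (2 * Real.pi - t) = h t) (hp : Function.Periodic h (2 * Real.pi)) {n : ℕ}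
    (hn : n ≠ 0) :
    ∫ u in (0 : ℝ)..(2 * Real.pi), h (n * u) = 2 * ∫ t in (0 : ℝ)..Real.pi, h t := by
  have hn' : (n : ℝ) ≠ 0 := Nat.cast_ne_zero.2 hn
  have h1 := hp.intervalIntegral_add_zsmul_eq n 0
    fun a b => hc.intervalIntegrable a b
  rw [intervalIntegral.integral_comp_mul_left h hn', ← integral_two_pi_of_symm hc hs]
  simp only [zero_add, zsmul_eq_mul, Int.cast_natCast] at h1
  rw [mul_zero, h1, smul_eq_mul, inv_mul_cancel_left₀ hn']

section ClosedCurve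

variable {σ d : ℝ} {m n : ℕ}

theorem periodic_comp_cos (f : ℝ → ℝ) : Function.Periodic (fun t => f (Real.cos t)) (2 * Real.pi) :=
  fun t => by simp only [Real.cos_add_two_pi]

theorem integral_comp_cos_nat_mul {f : ℝ → ℝ} (hc : Continuous fun t => f (Real.cos t))
    (hn : n ≠ 0) :
    ∫ u in (0 : ℝ)..(2 * Real.pi), f (Real.cos (n * u)) =
      2 * ∫ t in (0 : ℝ)..Real.pi, f (Real.cos t) :=
  integral_comp_nat_mul hc (fun t => by rw [Real.cos_two_pi_sub]) (periodic_comp_cos f) hn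

theorem tangentAngle_add_two_pi (hσ : 0 < σ) (hd : 0 ≤ d) (φ : ℝ) :
    tangentAngle σ d (φ + 2 * Real.pi) = tangentAngle σ d φ + 2 * halfTurn σ d := by
  have i := continuous_div_sqrt_weight hσ hd (f := fun φ => Real.exp (σ * Real.cos φ)) (by fun_prop)
  have hp := periodic_comp_cos fun c => Real.exp (σ * c) / √(weight σ d c)
  rw [tangentAngle, ← intervalIntegral.integral_add_adjacent_intervals (i.intervalIntegrable 0 φ)
    (i.intervalIntegrable _ _), hp.intervalIntegral_add_eq φ 0, zero_add,
    integral_two_pi_of_symm i (fun t => by rw [Real.cos_two_pi_sub]), tangentAngle, halfTurn]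

theorem tangentAngle_add_int_mul (hσ : 0 < σ) (hd : 0 ≤ d) (φ : ℝ) (k : ℤ) :
    tangentAngle σ d (φ + k * (2 * Real.pi)) = tangentAngle σ d φ + 2 * k * halfTurn σ d := by
  -- Subtracting the mean linear growth leaves a periodic function, which handles all integers `k`
  -- at once.
  have hp : Function.Periodic (fun φ => tangentAngle σ d φ - φ / Real.pi * halfTurn σ d)
      (2 * Real.pi) := fun φ => by
    simp only [tangentAngle_add_two_pi hσ hd]
    field_simp
    ring
  have h := hp.int_mul k φ
  have e : (φ + k * (2 * Real.pi)) / Real.pi = φ / Real.pi + 2 * k := by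
    field_simp
  rw [e] at h
  linear_combination h

theorem supportCurve_add_int_mul (hσ : 0 < σ) (hd : 0 ≤ d) (φ : ℝ) (k : ℤ) :
    supportCurve σ d (φ + k * (2 * Real.pi)) =
      Complex.exp ((2 * k * halfTurn σ d : ℝ) * Complex.I) * supportCurve σ d φ := by
  rw [supportCurve, supportCurve, tangentAngle_add_int_mul hσ hd, Real.cos_add_int_mul_two_pi,
    Real.sin_add_int_mul_two_pi, Complex.ofReal_add, add_mul, Complex.exp_add]
  ring

theorem norm_supportCurve_eq_iff (hσ : 0 < σ) (hd : 0 < d) (φ : ℝ) :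
    ‖supportCurve σ d φ‖ = ‖supportCurve σ d 0‖ ↔ Real.cos φ = 1 := by
  have hS : 0 < Real.sinh σ := Real.sinh_pos_iff.2 hσ
  rw [← sq_eq_sq₀ (norm_nonneg _) (norm_nonneg _), norm_sq_supportCurve hσ hd.le,
    norm_sq_supportCurve hσ hd.le, Real.cos_zero, add_right_inj]
  exact mul_right_inj' (by positivity)

theorem supportCurve_zero_ne_zero (hσ : 0 < σ) (hd : 0 < d) : supportCurve σ d 0 ≠ 0 := by
  have hS : 0 < Real.sinh σ := Real.sinh_pos_iff.2 hσ
  intro h0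
  have h := norm_sq_supportCurve hσ hd.le 0
  have : (Real.cosh σ - d) ^ 2 - 1 + 2 * d * Real.cosh σ + 2 * d * Real.sinh σ * 1 =
      (Real.sinh σ + d) ^ 2 := by
    linear_combination Real.cosh_sq σ
  rw [h0, norm_zero, Real.cos_zero, this] at h
  have : 0 < (Real.sinh σ + d) ^ 2 := by positivity
  linarith

theorem hasDerivAt_supportCurve_comp (hσ : 0 < σ) (hd : 0 ≤ d) (n : ℕ) (u : ℝ) :
    HasDerivAt (fun u => supportCurve σ d (n * u))
      ((n * ((d * Real.sinh σ / σ) / √(weight σ d (Real.cos (n * u)))) : ℝ) *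
        Complex.exp (tangentAngle σ d (n * u) * Complex.I)) u := by
  have h := (hasDerivAt_supportCurve hσ hd (n * u)).scomp u ((hasDerivAt_id u).const_mul (n : ℝ))
  refine h.congr_deriv ?_
  rw [Complex.real_smul]
  push_cast
  ring

/-- The rotations of the plane which preserve the closed curve. -/
theorem isRotSymmetric_supportCurve (hσ : 0 < σ) (hd : 0 < d) (hn : n ≠ 0)
    (hmn : Nat.Coprime m n) (hQ : halfTurn σ d = Real.pi * m / n) :
    IsRotSymmetric n fun u => supportCurve σ d (n * u) := by
  have hn' : (n : ℝ) ≠ 0 := Nat.cast_ne_zero.2 hn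
  refine ⟨0, fun α => ⟨fun h => ?_, ?_⟩⟩
  · have h1 : rotationAbout 0 α (supportCurve σ d 0) ∈
        Set.range fun u => supportCurve σ d (n * u) := by
      rw [← h]
      exact Set.mem_image_of_mem _ ⟨0, by simp⟩
    obtain ⟨u, hu⟩ := h1
    simp only [rotationAbout, sub_zero, zero_add] at hu
    -- A rotation about `0` preserves distances to `0`, so it sends a farthest point to a farthest
    -- point.
    have hcos : Real.cos (n * u) = 1 := by
      rw [← norm_supportCurve_eq_iff hσ hd, hu, norm_mul, Complex.norm_exp_ofReal_mul_I, one_mul]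
    obtain ⟨k, hk⟩ := (Real.cos_eq_one_iff _).1 hcos
    have h2 := supportCurve_add_int_mul hσ hd.le 0 k
    rw [zero_add, hk, hu] at h2
    have h3 := mul_right_cancel₀ (supportCurve_zero_ne_zero hσ hd) h2
    obtain ⟨l, hl⟩ := Complex.exp_eq_exp_iff_exists_int.1 h3
    have hl' : ((α : ℝ) : ℂ) = ((2 * k * halfTurn σ d + l * (2 * Real.pi) : ℝ) : ℂ) := by
      refine mul_right_cancel₀ Complex.I_ne_zero ?_
      rw [hl]
      push_cast
      ring
    refine ⟨k * m + l * n, ?_⟩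
    rw [Complex.ofReal_inj.1 hl', hQ]
    push_cast
    field_simp
  · rintro ⟨j, rfl⟩
    -- A shift by `k` periods rotates by `2πkm/n`; Bézout's identity produces every multiple of
    -- `2π/n`.
    have hb := Nat.gcd_eq_gcd_ab m n
    rw [hmn.gcd_eq_one] at hb
    set k : ℤ := m.gcdA n * j with hk
    set l : ℤ := m.gcdB n * j with hl
    have hkl : (j : ℝ) = m * k + n * l := by
      have : j = m * k + n * l := by
        rw [hk, hl]
        push_cast at hb
        linear_combination j * hb
      exact_mod_cast this
    have hrot : rotationAbout 0 (2 * Real.pi * j / n) ∘ (fun u => supportCurve σ d (n * u)) =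
        (fun u => supportCurve σ d (n * u)) ∘ fun u => u + k * (2 * Real.pi) / n := by
      funext u
      have e : (n : ℝ) * (u + k * (2 * Real.pi) / n) = n * u + k * (2 * Real.pi) := by
        field_simp
      simp only [Function.comp, rotationAbout, sub_zero, zero_add, e]
      rw [supportCurve_add_int_mul hσ hd.le]
      congr 1
      refine Complex.exp_eq_exp_iff_exists_int.2 ⟨l, ?_⟩
      have e2 : 2 * Real.pi * j / n = 2 * k * halfTurn σ d + l * (2 * Real.pi) := by
        rw [hQ, hkl]
        field_simp
      rw [e2]
      push_cast
      ring
    rw [← Set.range_comp, hrot]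
    exact (Equiv.addRight (k * (2 * Real.pi) / n : ℝ)).surjective.range_comp _

theorem isClosedImmersion_supportCurve (hσ : 0 < σ) (hd : 0 < d) (hn : n ≠ 0)
    (hQ : halfTurn σ d = Real.pi * m / n) :
    IsClosedImmersion fun u => supportCurve σ d (n * u) where
  smooth := (contDiff_supportCurve hσ hd.le).comp (by fun_prop)
  periodic u := by
    have hn' : (n : ℝ) ≠ 0 := Nat.cast_ne_zero.2 hn
    have h := supportCurve_add_int_mul hσ hd.le (n * u) n
    have e : Complex.exp ((2 * (n : ℤ) * halfTurn σ d : ℝ) * Complex.I) = 1 := by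
      rw [hQ, Complex.exp_eq_one_iff]
      refine ⟨m, ?_⟩
      rw [show 2 * ((n : ℤ) : ℝ) * (Real.pi * m / n) = 2 * Real.pi * m by push_cast; field_simp]
      push_cast
      ring
    rw [e, one_mul, Int.cast_natCast, ← mul_add] at h
    exact h
  immersion u := by
    have hS : 0 < Real.sinh σ := Real.sinh_pos_iff.2 hσ
    have hr := sqrt_weight_pos hσ hd.le (n * u)
    have hn' : (0 : ℝ) < n := Nat.cast_pos.2 hn.bot_lt
    rw [(hasDerivAt_supportCurve_comp hσ hd.le n u).deriv]
    exact mul_ne_zero (Complex.ofReal_ne_zero.2 (by positivity)) (Complex.exp_ne_zero _)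

theorem inner_supportCurve_neg_normal (φ : ℝ) :
    inner ℝ (supportCurve σ d φ) (-(Complex.I * Complex.exp (tangentAngle σ d φ * Complex.I))) =
      Real.exp (σ * Real.cos φ) - (Real.cosh σ - d) := by
  rw [← neg_mul, supportCurve, inner_mul_exp, Complex.inner]
  simp [-Complex.ofReal_exp]

end ClosedCurve

end PlaneCurve

end

/-! ### Assembly of the shrinker -/

theorem theoremA (m n : ℕ) (hmn : Nat.Coprime m n)
    (hlower : (1 / 2 : ℝ) < (m : ℝ) / (n : ℝ)) (hupper : (m : ℝ) / (n : ℝ) < 1) :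
    ∃ x : ℝ → ℂ, PlaneCurve.IsClosedImmersion x ∧
      PlaneCurve.IsAPCSFShrinker x ∧
      ¬ PlaneCurve.IsCircular x ∧
      PlaneCurve.IsRotSymmetric n x ∧
      PlaneCurve.HasTurningIndex x (m : ℤ) ∧
      PlaneCurve.IsLambdaCurve (PlaneCurve.avgCurvature x) x ∧
      PlaneCurve.signedArea x = 0 := by
  open PlaneCurve in
  have hn : n ≠ 0 := by
    rintro rfl
    norm_num at hlower
  have hnpos : (0 : ℝ) < n := Nat.cast_pos.2 hn.bot_lt
  obtain ⟨σ, d, hσ, hd, -, hA, hQ⟩ := exists_halfTurn_eq (τ := Real.pi * m / n)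
    (by rw [mul_div_assoc]; nlinarith [Real.pi_pos]) (by rw [mul_div_assoc]; nlinarith [Real.pi_pos])
  have hS : 0 < Real.sinh σ := Real.sinh_pos_iff.2 hσ
  have hε : 0 < d * Real.sinh σ / σ := by positivity
  have hx := hasDerivAt_supportCurve_comp hσ hd.le n
  set ε := d * Real.sinh σ / σ
  set x : ℝ → ℂ := fun u => supportCurve σ d (n * u) with hxd
  have hr : ∀ φ : ℝ, 0 < √(weight σ d (Real.cos φ)) := sqrt_weight_pos hσ hd.le
  have hρ : ∀ u : ℝ, 0 < n * (ε / √(weight σ d (Real.cos (n * u)))) := fun u => by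
    have := hr (n * u)
    positivity
  have hρd : Differentiable ℝ fun u : ℝ => n * (ε / √(weight σ d (Real.cos (n * u)))) := by
    have h1 : Differentiable ℝ fun φ : ℝ => ε / √(weight σ d (Real.cos φ)) :=
      (differentiable_const ε).div ((contDiff_sqrt_weight hσ hd.le).differentiable (by simp))
        fun φ => (hr φ).ne'
    exact (h1.comp (by fun_prop : Differentiable ℝ fun u : ℝ => n * u)).const_mul _
  have hθ : ∀ u : ℝ, HasDerivAt (fun u : ℝ => tangentAngle σ d (n * u))
      (n * (Real.exp (σ * Real.cos (n * u)) / √(weight σ d (Real.cos (n * u))))) u := fun u => by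
    refine ((hasDerivAt_tangentAngle hσ hd.le (n * u)).comp u
      ((hasDerivAt_id u).const_mul (n : ℝ))).congr_deriv ?_
    ring
  have hspeed := norm_deriv_of_hasDerivAt hx hρ
  have hκ : ∀ u, curvature x u = Real.exp (σ * Real.cos (n * u)) / ε := fun u => by
    rw [curvature_of_hasDerivAt hx hρ hρd hθ]
    have := hr (n * u)
    field_simp
  have hinner : ∀ u, inner ℝ (x u) (-normal x u) =
      Real.exp (σ * Real.cos (n * u)) - (Real.cosh σ - d) := fun u => by
    rw [normal_of_hasDerivAt hx hρ]
    exact inner_supportCurve_neg_normal _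
  have i₁ := continuous_div_sqrt_weight hσ hd.le (f := fun _ => 1) (by fun_prop)
  have i₂ := continuous_div_sqrt_weight hσ hd.le (f := fun φ => Real.exp (σ * Real.cos φ))
    (by fun_prop)
  have i₃ := continuous_div_sqrt_weight hσ hd.le
    (f := fun φ => Real.cosh σ - d - Real.exp (σ * Real.cos φ)) (by fun_prop)
  have hlen : length x = n * ε *
      (2 * ∫ φ in (0 : ℝ)..Real.pi, 1 / √(weight σ d (Real.cos φ))) := by
    rw [← integral_comp_cos_nat_mul (f := fun c => 1 / √(weight σ d c)) i₁ hn,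
      ← intervalIntegral.integral_const_mul, length]
    refine intervalIntegral.integral_congr fun u _ => ?_
    simp only [hspeed]
    ring
  have hturn : ∫ u in (0 : ℝ)..(2 * Real.pi), curvature x u * ‖deriv x u‖ =
      n * (2 * halfTurn σ d) := by
    rw [halfTurn, ← integral_comp_cos_nat_mul
      (f := fun c => Real.exp (σ * c) / √(weight σ d c)) i₂ hn,
      ← intervalIntegral.integral_const_mul]
    refine intervalIntegral.integral_congr fun u _ => ?_
    simp only [hspeed, hκ]
    field_simp
  have harea : signedArea x = 0 := by
    have h : ∫ u in (0 : ℝ)..(2 * Real.pi), inner ℝ (x u) (-normal x u) * ‖deriv x u‖ =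
        -(n * ε) * (2 * areaIntegral σ d) := by
      rw [areaIntegral, ← integral_comp_cos_nat_mul
        (f := fun c => (Real.cosh σ - d - Real.exp (σ * c)) / √(weight σ d c)) i₃ hn,
        ← intervalIntegral.integral_const_mul]
      refine intervalIntegral.integral_congr fun u _ => ?_
      simp only [hspeed, hinner]
      ring
    rw [signedArea, h, hA]
    ring
  have havg : avgCurvature x = (Real.cosh σ - d) / ε := by
    have hI : 0 < ∫ φ in (0 : ℝ)..Real.pi, 1 / √(weight σ d (Real.cos φ)) :=
      intervalIntegral.intervalIntegral_pos_of_pos_on (i₁.intervalIntegrable _ _)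
        (fun φ _ => one_div_pos.2 (hr φ)) Real.pi_pos
    have h := areaIntegral_eq hσ hd.le
    rw [hA] at h
    -- Vanishing of the area integral replaces the half turn by `(cosh σ - d) ∫ 1/√weight`, and the
    -- integral cancels against the length.
    rw [avgCurvature, hturn, hlen, ← sub_eq_zero.1 h.symm]
    field_simp
  have hlambda : IsLambdaCurve (avgCurvature x) x := by
    refine ⟨1 / ε, 0, by positivity, fun u => ?_⟩
    rw [sub_zero, hinner, hκ, havg]
    ring
  have himm := isClosedImmersion_supportCurve hσ hd hn hQ
  refine ⟨x, himm, hlambda.isAPCSFShrinker himm, fun hcirc => ?_,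
    isRotSymmetric_supportCurve hσ hd hn hmn hQ, ?_, hlambda, harea⟩
  · obtain ⟨r, h⟩ := hcirc.exists_curvature hx hρ hρd hθ
    have h0 := h 0
    -- At `0` and `π/n` the curvature takes its positive maximum and minimum, so no common radius is
    -- possible.
    have h1 := h (Real.pi / n)
    have e : (n : ℝ) * (Real.pi / n) = Real.pi := by field_simp
    rw [hκ, mul_zero, Real.cos_zero, mul_pow] at h0
    rw [hκ, e, Real.cos_pi, mul_pow] at h1
    have hlt : Real.exp (σ * -1) / ε < Real.exp (σ * 1) / ε :=
      div_lt_div_of_pos_right (Real.exp_lt_exp.2 (by linarith)) hε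
    have hlt' : (Real.exp (σ * -1) / ε) ^ 2 < (Real.exp (σ * 1) / ε) ^ 2 :=
      pow_lt_pow_left₀ hlt (by positivity) two_ne_zero
    have hr2 : 0 < r ^ 2 := pos_of_mul_pos_right (h0 ▸ one_pos) (sq_nonneg _)
    nlinarith
  · refine ⟨fun u => tangentAngle σ d (n * u),
      (contDiff_tangentAngle hσ hd.le).continuous.comp (by fun_prop),
      tangent_of_hasDerivAt hx hρ, fun u => ?_⟩
    have h := tangentAngle_add_int_mul hσ hd.le (n * u) n
    rw [Int.cast_natCast, ← mul_add] at h
    simp only [h, hQ, Int.cast_natCast]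
    field_simp
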